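/- Let $\Omega$ be a properly convex open subset of the real projective plane $\mathbb{P}^2$, i.e. an open set whose intersection with every projective line is connected (possibly empty) and whose closure $\overline{\Omega}$ is contained in some affine open set (the complement of a projective line). Let $\mathrm{Aut}(\Omega)$ be the group of all $\gamma\in\mathrm{SL}_3(\mathbb{R})$ with $\gamma(\Omega)=\Omega$. Choose any affine open set $A\supset\overline{\Omega}$ and a Euclidean norm $\|\cdot\|$ on $A$, and let $\mathrm{Vol}$ be Lebesgue measure on $A$ normalized so that the open unit ball has measure $1$. For $x\in\Omega$ and $v\ne 0$ let $p^{+}$, $p^{-}$ be the points where the half-lines from $x$ in the directions $v$, $-v$ meet $\partial\Omega$; put $\|v\|_x=\left(\frac{1}{\|x-p^-\|}+\frac{1}{\|x-p^+\|}\right)\|v\|$, $\|0\|_x=0$, and $B_x(1)=\{v : \|v\|_x<1\}$. The Busemann measure of a Borel set $S\subset\Omega$ is $\mu_\Omega(S)=\int_S \frac{d\mathrm{Vol}(x)}{\mathrm{Vol}(B_x(1))}$ (the assertions below hold for every choice of $A$ and $\|\cdot\|$). A peak of $\Omega$ with vertex at infinity $p$ is an open triangle $P\subset\Omega$ having exactly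 one vertex, namely $p$, on $\partial\Omega$. An element of $\mathrm{SL}_3(\mathbb{R})$ is called - parabolic if it is conjugate to $\begin{pmatrix}1&1&0\\0&1&1\\0&0&1\end{pmatrix}$; - quasi-hyperbolic if it is conjugate to $\begin{pmatrix}\alpha&1&0\\0&\alpha&0\\0&0&\beta\end{pmatrix}$ with $\alpha,\beta>0$, $\alpha^2\beta=1$, $\alpha,\beta\neq1$; - hyperbolic if it is conjugate to $\mathrm{diag}(\lambda^+,\lambda^0,\lambda^-)$ with $\lambda^+>\lambda^0>\lambda^->0$ and $\lambda^+\lambda^0\lambda^-=1$; then $p^+_\gamma,p^0_\gamma,p^-_\gamma\in\mathbb{P}^2$ denote the corresponding eigenpoints, and for hyperbolic $\gamma\in\mathrm{Aut}(\Omega)$ the axis $\mathrm{Axe}(\gamma)$ is the open segment of the line $(p^-_\gamma p^+_\gamma)$ with endpoints $p^-_\gamma,p^+_\gamma$ that is contained in $\overline{\Omega}$. **Proposition.** Let $P$ be a peak of $\Omega$ whose vertex at infinity $p\in\partial\Omega$ is fixed by a nontrivial element $\gamma\in\mathrm{Aut}(\Omega)$. 1. If $\gamma$ is parabolic, then $\mu_\Omega(P)<\infty$.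 2. If $\gamma$ is quasi-hyperbolic, then $\mu_\Omega(P)=\infty$. 3. If $\gamma$ is hyperbolic and $\mathrm{Axe}(\gamma)\subset\partial\Omega$, then $\mu_\Omega(P)=\infty$. 4. If $\gamma$ is hyperbolic and $p=p^0_\gamma$ (so that $p^0_\gamma\in\partial\Omega$), then $\mu_\Omega(P)=\infty$. -/

import Mathlib

open MeasureTheory
open scoped LinearAlgebra.Projectivization MatrixGroups Pointwise ENNReal

noncomputable section

namespace Hilbert

/-- The real projective plane. -/
abbrev Plane : Type := ℙ ℝ (Fin 3 → ℝ)

/-- The Euclidean plane in which affine charts of the projective plane take their values. -/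
abbrev E2 : Type := EuclideanSpace ℝ (Fin 2)

/-- The usual topology of the projective plane: the quotient topology from `ℝ³ ∖ {0}`. -/
instance instTopologicalSpacePlane : TopologicalSpace Plane :=
  TopologicalSpace.coinduced
    (fun v : {v : Fin 3 → ℝ // v ≠ 0} => Projectivization.mk ℝ v.1 v.2) inferInstance

/-! ### Affine charts -/

/-- The vector `x₀ b₀ + x₁ b₁ + b₂`. -/
def affineVec (b : Module.Basis (Fin 3) ℝ (Fin 3 → ℝ)) (x : E2) : Fin 3 → ℝ :=
  x 0 • b 0 + x 1 • b 1 + b 2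

theorem affineVec_ne_zero (b : Module.Basis (Fin 3) ℝ (Fin 3 → ℝ)) (x : E2) :
    affineVec b x ≠ 0 := by
  intro h
  have h2 := congrArg (fun v => b.repr v 2) h
  simp [affineVec] at h2

/-- The affine chart attached to a basis `b` of `ℝ³`, as a parametrization of the affine open set
`Set.range (affineChart b)`, the complement of the projective line spanned by `b₀` and `b₁`.
All pairs (affine open set, Euclidean norm on it) are obtained in this way. -/
def affineChart (b : Module.Basis (Fin 3) ℝ (Fin 3 → ℝ)) (x : E2) : Plane :=
  Projectivization.mk ℝ (affineVec b x) (affineVec_ne_zero b x)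

/-! ### Properly convex sets and their automorphisms -/

/-- The projective line defined by a (two-dimensional) subspace of `ℝ³`. -/
def projLine (L : Submodule ℝ (Fin 3 → ℝ)) : Set Plane := {x | x.submodule ≤ L}

/-- A subset of the projective plane is convex if its intersection with every projective line
is connected (possibly empty). -/
def IsProjConvex (C : Set Plane) : Prop :=
  ∀ L : Submodule ℝ (Fin 3 → ℝ), Module.finrank ℝ L = 2 → IsPreconnected (C ∩ projLine L)

/-- A convex set is properly convex if some affine open set contains its closure. -/
def IsProperlyConvex (C : Set Plane) : Prop :=
  IsProjConvex C ∧
    ∃ b : Module.Basis (Fin 3) ℝ (Fin 3 → ℝ), closure C ⊆ Set.range (affineChart b)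

/-- The group of elements `γ` of `SL₃(ℝ)` with `γ(Ω) = Ω`. -/
def Aut (Ω : Set Plane) : Subgroup SL(3, ℝ) := MulAction.stabilizer SL(3, ℝ) Ω

/-! ### The Finsler metric and the Busemann measure, in an affine chart -/

/-- `sup {t ≥ 0 | x + t v ∈ U}`. -/
def exitTime (U : Set E2) (x v : E2) : ℝ := sSup {t : ℝ | 0 ≤ t ∧ x + t • v ∈ U}

/-- For a bounded convex open `U`, `x ∈ U` and `v ≠ 0`: the point where the half-line from `x`
in the direction `v` meets the boundary of `U`. -/
def exitPoint (U : Set E2) (x v : E2) : E2 := x + exitTime U x v • v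

/-- The Finsler norm `‖v‖ₓ = (1 / ‖x - p⁻‖ + 1 / ‖x - p⁺‖) ‖v‖`, where `p⁺` and `p⁻` are the points
where the half-lines from `x` in the directions `v` and `-v` meet the boundary. -/
def finslerNorm (U : Set E2) (x v : E2) : ℝ :=
  (1 / ‖x - exitPoint U x (-v)‖ + 1 / ‖x - exitPoint U x v‖) * ‖v‖

/-- The open unit ball of the Finsler norm at `x`. -/
def finslerBall (U : Set E2) (x : E2) : Set E2 := {v | finslerNorm U x v < 1}

/-- Lebesgue measure, normalized so that the Euclidean open unit ball has measure `1`. -/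
def normVol : Measure E2 := ((volume : Measure E2) (Metric.ball 0 1))⁻¹ • volume

/-- The Busemann volume `μ_Ω(S)` of a Borel subset `S` of `Ω`, computed in the affine chart attached
to `b`; here `closure Ω` has to be contained in the affine open set of the chart. -/
def busemannVolume (b : Module.Basis (Fin 3) ℝ (Fin 3 → ℝ)) (Ω S : Set Plane) : ℝ≥0∞ :=
  ∫⁻ x in affineChart b ⁻¹' S, (normVol (finslerBall (affineChart b ⁻¹' Ω) x))⁻¹ ∂normVol

/-! ### Peaks -/

/-- `T` is an open triangle with (non-collinear) vertices `p₁`, `p₂`, `p₃`, that is, one of the four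
connected components of the complement of the three lines joining these points. -/
def IsOpenTriangle (p₁ p₂ p₃ : Plane) (T : Set Plane) : Prop :=
  ∃ u : Fin 3 → (Fin 3 → ℝ), LinearIndependent ℝ u ∧
    (∃ h, p₁ = Projectivization.mk ℝ (u 0) h) ∧
    (∃ h, p₂ = Projectivization.mk ℝ (u 1) h) ∧
    (∃ h, p₃ = Projectivization.mk ℝ (u 2) h) ∧
    T = {x | ∃ r s t : ℝ, 0 < r ∧ 0 < s ∧ 0 < t ∧
      ∃ h, x = Projectivization.mk ℝ (r • u 0 + s • u 1 + t • u 2) h}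

/-- `P` is a peak of `Ω` with vertex at infinity `p`: an open triangle contained in `Ω` which has
`p`, and no other vertex, on the boundary of `Ω`. -/
def IsPeak (Ω : Set Plane) (p : Plane) (P : Set Plane) : Prop :=
  P ⊆ Ω ∧ ∃ q r : Plane, IsOpenTriangle p q r P ∧
    p ∈ frontier Ω ∧ q ∉ frontier Ω ∧ r ∉ frontier Ω

/-! ### Types of elements of `SL₃(ℝ)` -/

/-- `γ` is conjugate to the matrix `M`. -/
def ConjTo (γ : SL(3, ℝ)) (M : Matrix (Fin 3) (Fin 3) ℝ) : Prop :=
  ∃ g : GL (Fin 3) ℝ, (γ : Matrix (Fin 3) (Fin 3) ℝ) =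
    (g : Matrix (Fin 3) (Fin 3) ℝ) * M * ((g⁻¹ : GL (Fin 3) ℝ) : Matrix (Fin 3) (Fin 3) ℝ)

def IsParabolic (γ : SL(3, ℝ)) : Prop := ConjTo γ !![1, 1, 0; 0, 1, 1; 0, 0, 1]

def IsQuasiHyperbolic (γ : SL(3, ℝ)) : Prop :=
  ∃ α β : ℝ, 0 < α ∧ 0 < β ∧ α ^ 2 * β = 1 ∧ α ≠ 1 ∧ β ≠ 1 ∧
    ConjTo γ !![α, 1, 0; 0, α, 0; 0, 0, β]

/-- `p` is the class of an eigenvector of `γ` for the eigenvalue `c`. -/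
def IsEigenpoint (γ : SL(3, ℝ)) (c : ℝ) (p : Plane) : Prop :=
  ∃ (v : Fin 3 → ℝ) (h : v ≠ 0),
    (γ : Matrix (Fin 3) (Fin 3) ℝ).mulVec v = c • v ∧ p = Projectivization.mk ℝ v h

/-- `γ` is hyperbolic, and `pp`, `p0`, `pm` are its eigenpoints `p⁺`, `p⁰`, `p⁻` for the eigenvalues
`lp > l0 > lm > 0`. Every hyperbolic element has exactly one such triple of points. -/
def IsHyperbolicWith (γ : SL(3, ℝ)) (pp p0 pm : Plane) : Prop :=
  ∃ lp l0 lm : ℝ, l0 < lp ∧ lm < l0 ∧ 0 < lm ∧ lp * l0 * lm = 1 ∧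
    ConjTo γ !![lp, 0, 0; 0, l0, 0; 0, 0, lm] ∧
    IsEigenpoint γ lp pp ∧ IsEigenpoint γ l0 p0 ∧ IsEigenpoint γ lm pm

/-- `S` is one of the two open segments with endpoints `p ≠ q` of the projective line `(pq)`. -/
def IsOpenSegment (p q : Plane) (S : Set Plane) : Prop :=
  p ≠ q ∧ ∃ (u v : Fin 3 → ℝ) (hu : u ≠ 0) (hv : v ≠ 0),
    p = Projectivization.mk ℝ u hu ∧ q = Projectivization.mk ℝ v hv ∧
    S = {x | ∃ s t : ℝ, 0 < s ∧ 0 < t ∧ ∃ h, x = Projectivization.mk ℝ (s • u + t • v) h}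

/-- `S` is the axis in `Ω` of a hyperbolic element with attracting point `pp` and repelling point
`pm`: the open segment with endpoints `pm` and `pp` contained in the closure of `Ω`. -/
def IsAxis (Ω : Set Plane) (pp pm : Plane) (S : Set Plane) : Prop :=
  IsOpenSegment pm pp S ∧ S ⊆ closure Ω

end Hilbert

end

/-!
The proof takes place in the open convex cone `C` of `ℝ³` over `Ω` (`coneOver`) on which the
functional `φ = b.coord 2` defining the line at infinity of the chart is positive. Convexity of
`C` follows from the connectedness of the traces of `Ω` on lines, and proper convexity gives
`m * ‖v‖ ≤ φ v` on `C` for some `m > 0`. The square of an automorphism preserves `C`.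

Let `U` be the trace of `Ω` in the chart. Up to a factor `2`, the unit ball of the Finsler norm at
`x` is the set of all `v` with `x + v ∈ U` and `x - v ∈ U` (`mem_of_mem_finslerBall`,
`mem_finslerBall`). A peak is cut into the strips at distance of order `ρ ^ n` from its vertex, whose
areas are of order `ρ ^ (2 n)`. The question thus becomes how large a box fits into `U`,
symmetrically around a point of the `n`-th strip.

* If `U` lies in a sector with apex at the vertex, the unit ball has area at most of order
  `ρ ^ (2 n)`, so every strip contributes at least a fixed amount. This still works if the sector is
  slightly widened, so that the unit ball is contained in a box with sides of order `n ρ ^ n` and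
  `ρ ^ n`: the volume is then bounded below by the harmonic series
  (`peakVolume_eq_top_of_growth`, `peakVolume_eq_top_of_corner`).
* If `U` contains the interior of a conic through the vertex, then with `ρ = 1 / 4` the unit ball
  contains a box with sides of order `2 ^ (-n)` and `4 ^ (-n)`, so that the volume is bounded above
  by a geometric series (`peakVolume_lt_top_of_conic`).

It remains to read the shape of `Ω` near the fixed point from the dynamics. If the rescaled orbits
of a map preserving `C` converge to `l v • e`, then `φ e * l` is positive on `C`
(`IsProperCone.mul_pos_of_tendsto`). In the hyperbolic case this applies to the coordinates of the
attracting and of the repelling point, which gives a corner at `p⁰`; if the axis is in the boundary,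
the third coordinate has no zero on `C` either, and `Ω` lies in a triangle with vertices the
three eigenpoints. In the quasi-hyperbolic case one fixed point is a corner; at the other one,
`φ > 0` along a whole orbit bounds the logarithmic widening of the sector
(`peakVolume_eq_top_of_isJordanMap`). In the parabolic case, the chords between consecutive points of
an orbit lie at bounded height over a parabola, so that `Ω` contains the
interior of a conic (`exists_conic_subset`).
-/

noncomputable section

namespace Hilbert

section

/-! ### The area of parallelograms -/

instance isAddHaarMeasure_normVol : (normVol : Measure E2).IsAddHaarMeasure :=
  Measure.IsAddHaarMeasure.smul _
    (ENNReal.inv_ne_zero.2 measure_ball_lt_top.ne)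
    (ENNReal.inv_ne_top.2 (Metric.measure_ball_pos volume (0 : E2) one_pos).ne')

/-- The open parallelogram `|F₁| < a`, `|F₂| < c` in the plane. -/
def parallelogram (F₁ F₂ : E2 →ₗ[ℝ] ℝ) (a c : ℝ) : Set E2 := {v | |F₁ v| < a ∧ |F₂ v| < c}

theorem exists_normVol_parallelogram (F₁ F₂ : E2 →ₗ[ℝ] ℝ)
    (hF : ∀ v, F₁ v = 0 → F₂ v = 0 → v = 0) :
    ∃ κ : ℝ, 0 < κ ∧ ∀ a c : ℝ, 0 < a → 0 < c →
      normVol (parallelogram F₁ F₂ a c) = ENNReal.ofReal (κ * (a * c)) := by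
  let f : E2 →ₗ[ℝ] E2 :=
    (WithLp.linearEquiv 2 ℝ (Fin 2 → ℝ)).symm.toLinearMap ∘ₗ LinearMap.pi ![F₁, F₂]
  have hf0 : ∀ v, f v 0 = F₁ v := fun v => rfl
  have hf1 : ∀ v, f v 1 = F₂ v := fun v => rfl
  have hinj : Function.Injective f := by
    rw [injective_iff_map_eq_zero]
    intro v hv
    refine hF v ?_ ?_
    · rw [← hf0, hv]; rfl
    · rw [← hf1, hv]; rfl
  have hdet : LinearMap.det f ≠ 0 := by
    intro h
    exact (LinearMap.bot_lt_ker_of_det_eq_zero h).ne' (LinearMap.ker_eq_bot.2 hinj)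
  have hball : 0 < (((volume : Measure E2) (Metric.ball 0 1))⁻¹).toReal :=
    ENNReal.toReal_pos (ENNReal.inv_ne_zero.2 measure_ball_lt_top.ne)
      (ENNReal.inv_ne_top.2 (Metric.measure_ball_pos volume (0 : E2) one_pos).ne')
  refine ⟨(((volume : Measure E2) (Metric.ball 0 1))⁻¹).toReal *
    (|(LinearMap.det f)⁻¹| * 4), by positivity, ?_⟩
  · intro a c ha hc
    let R : Set (Fin 2 → ℝ) := Set.pi Set.univ fun i => Set.Ioo (-(![a, c] i)) (![a, c] i)
    have hset : parallelogram F₁ F₂ a c = f ⁻¹' ((WithLp.ofLp : E2 → Fin 2 → ℝ) ⁻¹' R) := by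
      ext v
      simp only [parallelogram, R, Set.mem_ofPred_eq, Set.mem_preimage, Set.mem_univ_pi,
        Fin.forall_fin_two, Set.mem_Ioo, abs_lt]
      rfl
    have hR : MeasurableSet R := MeasurableSet.univ_pi fun i => measurableSet_Ioo
    have hvol : (volume : Measure E2) ((WithLp.ofLp : E2 → Fin 2 → ℝ) ⁻¹' R)
        = ENNReal.ofReal (a * c) * ENNReal.ofReal 4 := by
      refine ((EuclideanSpace.volume_preserving_symm_measurableEquiv_toLp
        (Fin 2)).measure_preimage hR.nullMeasurableSet).trans ?_
      rw [Real.volume_pi_Ioo, Fin.prod_univ_two, ← ENNReal.ofReal_mul (by simp; linarith),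
        ← ENNReal.ofReal_mul (by positivity)]
      congr 1
      simp
      ring
    rw [hset, normVol, Measure.smul_apply, Measure.addHaar_preimage_linearMap _ hdet, hvol,
      smul_eq_mul, ENNReal.ofReal_mul (p := _ * _) (by positivity), ENNReal.ofReal_mul hball.le,
      ENNReal.ofReal_mul (p := |_|) (abs_nonneg _), ENNReal.ofReal_toReal
      (ENNReal.inv_ne_top.2 (Metric.measure_ball_pos volume (0 : E2) one_pos).ne')]
    ring

/-! ### The unit ball of the Finsler norm -/

section Finsler

variable {U : Set E2} {x v : E2}

theorem bddAbove_exitTime (hU : Bornology.IsBounded U) (hv : v ≠ 0) :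
    BddAbove {t : ℝ | 0 ≤ t ∧ x + t • v ∈ U} := by
  obtain ⟨R, hR⟩ := hU.exists_norm_le
  refine ⟨(R + ‖x‖) / ‖v‖, ?_⟩
  rintro t ⟨ht, htU⟩
  rw [le_div_iff₀ (norm_pos_iff.2 hv)]
  have h1 := hR _ htU
  have h2 : ‖t • v‖ ≤ ‖x + t • v‖ + ‖x‖ := by
    have := norm_sub_le (x + t • v) x
    rwa [add_sub_cancel_left] at this
  rw [norm_smul, Real.norm_of_nonneg ht] at h2
  linarith

theorem le_exitTime (hU : Bornology.IsBounded U) (hv : v ≠ 0) {t : ℝ} (ht : 0 ≤ t)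
    (h : x + t • v ∈ U) : t ≤ exitTime U x v :=
  le_csSup (bddAbove_exitTime hU hv) ⟨ht, h⟩

theorem lt_exitTime (hU : Bornology.IsBounded U) (ho : IsOpen U) (hv : v ≠ 0) {t : ℝ}
    (ht : 0 ≤ t) (h : x + t • v ∈ U) : t < exitTime U x v := by
  have hc : Continuous fun s : ℝ => x + s • v := by fun_prop
  have hn : (fun s : ℝ => x + s • v) ⁻¹' U ∈ nhds t := (ho.preimage hc).mem_nhds h
  obtain ⟨ε, hε, hball⟩ := Metric.mem_nhds_iff.1 hn
  have : t + ε / 2 ∈ Metric.ball t ε := by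
    rw [Metric.mem_ball, Real.dist_eq, add_sub_cancel_left, abs_of_pos (by positivity)]
    linarith
  have := le_exitTime hU hv (by positivity) (hball this)
  linarith

theorem mem_of_lt_exitTime (hc : Convex ℝ U) (hx : x ∈ U) {t : ℝ}
    (ht : 0 ≤ t) (h : t < exitTime U x v) : x + t • v ∈ U := by
  obtain ⟨s, ⟨hs, hsU⟩, hts⟩ := exists_lt_of_lt_csSup
    (s := {t : ℝ | 0 ≤ t ∧ x + t • v ∈ U}) ⟨0, le_rfl, by simpa using hx⟩ h
  have hs0 : 0 < s := ht.trans_lt hts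
  have := hc.add_smul_mem hx hsU (t := t / s) ⟨by positivity, (div_le_one hs0).2 hts.le⟩
  rwa [smul_smul, div_mul_cancel₀ _ hs0.ne'] at this

theorem norm_sub_exitPoint :
    ‖x - exitPoint U x v‖ = exitTime U x v * ‖v‖ := by
  have h0 : 0 ≤ exitTime U x v := Real.sSup_nonneg fun t ht => ht.1
  rw [exitPoint, sub_add_cancel_left, norm_neg, norm_smul, Real.norm_of_nonneg h0]

theorem finslerNorm_eq (hv : v ≠ 0) :
    finslerNorm U x v = (exitTime U x (-v))⁻¹ + (exitTime U x v)⁻¹ := by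
  have : ‖v‖ ≠ 0 := norm_ne_zero_iff.2 hv
  rw [finslerNorm, norm_sub_exitPoint, norm_sub_exitPoint, norm_neg, one_div, one_div,
    mul_inv, mul_inv, add_mul, inv_mul_cancel_right₀ this, inv_mul_cancel_right₀ this]

theorem exitTime_pos (hU : Bornology.IsBounded U) (ho : IsOpen U) (hx : x ∈ U) (hv : v ≠ 0) :
    0 < exitTime U x v :=
  lt_exitTime hU ho hv le_rfl (by simpa using hx)

theorem mem_of_mem_finslerBall (hU : Bornology.IsBounded U) (ho : IsOpen U) (hc : Convex ℝ U)
    (hx : x ∈ U) (h : v ∈ finslerBall U x) : x + v ∈ U ∧ x - v ∈ U := by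
  by_cases hv : v = 0
  · simpa [hv] using hx
  have hv' : -v ≠ 0 := neg_ne_zero.2 hv
  have h1 : finslerNorm U x v < 1 := h
  rw [finslerNorm_eq hv] at h1
  have hp := exitTime_pos hU ho hx hv
  have hm := exitTime_pos hU ho hx hv'
  have hp' := inv_pos.2 hp
  have hm' := inv_pos.2 hm
  have h2 : 1 < exitTime U x v := by
    rw [← inv_lt_one₀ hp]; linarith
  have h3 : 1 < exitTime U x (-v) := by
    rw [← inv_lt_one₀ hm]; linarith
  have h4 := mem_of_lt_exitTime hc hx zero_le_one h2
  have h5 := mem_of_lt_exitTime hc hx zero_le_one h3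
  rw [one_smul] at h4 h5
  exact ⟨h4, by rwa [sub_eq_add_neg]⟩

theorem mem_finslerBall (hU : Bornology.IsBounded U) (ho : IsOpen U)
    (h1 : x + (2 : ℝ) • v ∈ U) (h2 : x - (2 : ℝ) • v ∈ U) :
    v ∈ finslerBall U x := by
  change finslerNorm U x v < 1
  by_cases hv : v = 0
  · simp [hv, finslerNorm]
  have hv' : -v ≠ 0 := neg_ne_zero.2 hv
  rw [finslerNorm_eq hv]
  have hp := lt_exitTime hU ho hv zero_le_two h1
  have hm := lt_exitTime hU ho hv' zero_le_two (by rwa [smul_neg, ← sub_eq_add_neg])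
  have hp' := inv_strictAnti₀ two_pos hp
  have hm' := inv_strictAnti₀ two_pos hm
  linarith

end Finsler

/-! ### Divergence and convergence over a triangle cut into homothetic strips -/

/-- The open triangle with vertex `p` in the affine coordinates `f`, `g` centred at `p`. -/
def cornerTriangle (p : E2) (f g : E2 →ₗ[ℝ] ℝ) : Set E2 :=
  {x | 0 < f (x - p) ∧ 0 < g (x - p) ∧ f (x - p) + g (x - p) < 1}

/-- The part of the triangle on which `ρ ^ (n + 1) < f + g ≤ ρ ^ n`. -/
def triangleStrip (p : E2) (f g : E2 →ₗ[ℝ] ℝ) (ρ : ℝ) (n : ℕ) : Set E2 :=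
  cornerTriangle p f g ∩
    {x | ρ ^ (n + 1) < f (x - p) + g (x - p) ∧ f (x - p) + g (x - p) ≤ ρ ^ n}

section Strips

variable {p : E2} {f g : E2 →ₗ[ℝ] ℝ} {ρ : ℝ}

theorem iUnion_triangleStrip (h0 : 0 < ρ) (h1 : ρ < 1) :
    ⋃ n, triangleStrip p f g ρ n = cornerTriangle p f g := by
  refine Set.Subset.antisymm (Set.iUnion_subset fun n => Set.inter_subset_left) fun x hx => ?_
  obtain ⟨n, hn⟩ := exists_nat_pow_near_of_lt_one (add_pos hx.1 hx.2.1) hx.2.2.le h0 h1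
  exact Set.mem_iUnion.2 ⟨n, hx, hn⟩

theorem measurableSet_triangleStrip (n : ℕ) : MeasurableSet (triangleStrip p f g ρ n) := by
  have hf : Measurable fun x => f (x - p) :=
    (f.continuous_of_finiteDimensional.comp (continuous_sub_right p)).measurable
  have hg : Measurable fun x => g (x - p) :=
    (g.continuous_of_finiteDimensional.comp (continuous_sub_right p)).measurable
  refine MeasurableSet.inter ?_ ?_
  · exact (measurableSet_lt measurable_const hf).inter
      ((measurableSet_lt measurable_const hg).inter (measurableSet_lt (hf.add hg) measurable_const))
  · exact (measurableSet_lt measurable_const (hf.add hg)).inter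
      (measurableSet_le (hf.add hg) measurable_const)

theorem pairwise_disjoint_triangleStrip (h0 : 0 < ρ) (h1 : ρ < 1) :
    Pairwise (Function.onFun Disjoint (triangleStrip p f g ρ)) := by
  refine (Std.Symm.pairwise_on _).2 ?_
  intro m n hmn
  rw [Set.disjoint_left]
  intro x hx hy
  have h2 : ρ ^ n ≤ ρ ^ (m + 1) := pow_le_pow_of_le_one h0.le h1.le hmn
  linarith [hx.2.1, hy.2.2]

theorem setLIntegral_cornerTriangle (h0 : 0 < ρ) (h1 : ρ < 1) (F : E2 → ℝ≥0∞) :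
    ∫⁻ x in cornerTriangle p f g, F x ∂normVol =
      ∑' n, ∫⁻ x in triangleStrip p f g ρ n, F x ∂normVol := by
  rw [← iUnion_triangleStrip h0 h1, lintegral_iUnion measurableSet_triangleStrip
    (pairwise_disjoint_triangleStrip h0 h1)]

/-- Each strip contains a translate of a parallelogram with sides proportional to `ρ ^ n`. -/
theorem exists_le_normVol_triangleStrip (hfg : ∀ v, f v = 0 → g v = 0 → v = 0)
    (h0 : 0 < ρ) (h1 : ρ < 1) :
    ∃ d : ℝ, 0 < d ∧ ∀ n,
      ENNReal.ofReal (d * (ρ ^ n) ^ 2) ≤ normVol (triangleStrip p f g ρ n) := by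
  obtain ⟨κ, hκ, hvol⟩ := exists_normVol_parallelogram f g hfg
  have hs : Function.Surjective (f.prod g) := by
    have hi : Function.Injective (f.prod g) := by
      rw [injective_iff_map_eq_zero]
      intro v hv
      exact hfg v (congrArg Prod.fst hv) (congrArg Prod.snd hv)
    exact (LinearMap.injective_iff_surjective_of_finrank_eq_finrank (by simp)).1 hi
  refine ⟨κ * ((1 - ρ) / 8) ^ 2, by have := sub_pos.2 h1; positivity, fun n => ?_⟩
  have hρ : 0 < ρ ^ n := pow_pos h0 n
  have hρ1 : ρ ^ n ≤ 1 := pow_le_one₀ h0.le h1.le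
  obtain ⟨w, hw⟩ := hs (ρ ^ n * ((1 + ρ) / 4), ρ ^ n * ((1 + ρ) / 4))
  have hwf : f w = ρ ^ n * ((1 + ρ) / 4) := congrArg Prod.fst hw
  have hwg : g w = ρ ^ n * ((1 + ρ) / 4) := congrArg Prod.snd hw
  have hr : 0 < ρ ^ n * ((1 - ρ) / 8) := by have := sub_pos.2 h1; positivity
  have h2 := hvol _ _ hr hr
  rw [show κ * ((1 - ρ) / 8) ^ 2 * (ρ ^ n) ^ 2 =
    κ * (ρ ^ n * ((1 - ρ) / 8) * (ρ ^ n * ((1 - ρ) / 8))) by ring, ← h2,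
    ← measure_preimage_add normVol (-(p + w))]
  refine measure_mono fun x hx => ?_
  obtain ⟨hx1, hx2⟩ := hx
  beta_reduce at hx1 hx2
  have e : -(p + w) + x = (x - p) - w := by abel
  rw [e, map_sub, hwf, abs_lt] at hx1
  rw [e, map_sub, hwg, abs_lt] at hx2
  have hpos : 0 < ρ ^ n * ρ := mul_pos hρ h0
  have hsub : 0 < ρ ^ n * (1 - ρ) := mul_pos hρ (sub_pos.2 h1)
  refine ⟨⟨?_, ?_, ?_⟩, ?_, ?_⟩
  · linarith
  · linarith
  · linarith
  · rw [pow_succ]; linarith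
  · linarith

theorem exists_normVol_triangleStrip_le (hfg : ∀ v, f v = 0 → g v = 0 → v = 0) (h0 : 0 < ρ) :
    ∃ d : ℝ, 0 < d ∧ ∀ n,
      normVol (triangleStrip p f g ρ n) ≤ ENNReal.ofReal (d * (ρ ^ n) ^ 2) := by
  obtain ⟨κ, hκ, hvol⟩ := exists_normVol_parallelogram f g hfg
  refine ⟨κ * 4, by positivity, fun n => ?_⟩
  have hρ : 0 < ρ ^ n := pow_pos h0 n
  have h2 := hvol (2 * ρ ^ n) (2 * ρ ^ n) (by positivity) (by positivity)
  rw [show κ * 4 * (ρ ^ n) ^ 2 = κ * (2 * ρ ^ n * (2 * ρ ^ n)) by ring, ← h2,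
    ← measure_preimage_add normVol p (triangleStrip _ _ _ _ _)]
  refine measure_mono fun x hx => ?_
  obtain ⟨⟨hf, hg, -⟩, -, hle⟩ := hx
  rw [add_sub_cancel_left] at hf hg hle
  constructor <;> rw [abs_lt] <;> constructor <;> linarith

/-- If the set `B x` attached to a point of the `n`-th strip lies in a parallelogram with sides of
order `n ρ ^ n` and `ρ ^ n`, then each strip contributes at least a fixed multiple of `1 / (n + 1)`
to the integral. -/
theorem setLIntegral_cornerTriangle_eq_top (hfg : ∀ v, f v = 0 → g v = 0 → v = 0)
    (h0 : 0 < ρ) (h1 : ρ < 1) {F₁ F₂ : E2 →ₗ[ℝ] ℝ}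
    (hF : ∀ v, F₁ v = 0 → F₂ v = 0 → v = 0) {B : E2 → Set E2} {K : ℝ} (hK : 0 < K)
    (hB : ∀ n : ℕ, ∀ x ∈ triangleStrip p f g ρ n,
      B x ⊆ parallelogram F₁ F₂ (K * (n + 1) * ρ ^ n) (K * ρ ^ n)) :
    ∫⁻ x in cornerTriangle p f g, (normVol (B x))⁻¹ ∂normVol = ⊤ := by
  obtain ⟨d, hd, hstrip⟩ := exists_le_normVol_triangleStrip (p := p) hfg h0 h1
  obtain ⟨κ, hκ, hvol⟩ := exists_normVol_parallelogram F₁ F₂ hF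
  rw [setLIntegral_cornerTriangle h0 h1]
  have key : ∀ n : ℕ, ENNReal.ofReal (d / (κ * K ^ 2) * ((n + 1 : ℕ) : ℝ)⁻¹) ≤
      ∫⁻ x in triangleStrip p f g ρ n, (normVol (B x))⁻¹ ∂normVol := by
    intro n
    have hρ : 0 < ρ ^ n := pow_pos h0 n
    have hn : (0 : ℝ) < n + 1 := by positivity
    have hA : 0 < κ * (K * (n + 1) * ρ ^ n * (K * ρ ^ n)) := by positivity
    calc ENNReal.ofReal (d / (κ * K ^ 2) * ((n + 1 : ℕ) : ℝ)⁻¹)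
        = (ENNReal.ofReal (κ * (K * (n + 1) * ρ ^ n * (K * ρ ^ n))))⁻¹ *
            ENNReal.ofReal (d * (ρ ^ n) ^ 2) := by
          rw [← ENNReal.ofReal_inv_of_pos hA, ← ENNReal.ofReal_mul (inv_nonneg.2 hA.le)]
          congr 1
          push_cast
          field_simp
      _ ≤ (ENNReal.ofReal (κ * (K * (n + 1) * ρ ^ n * (K * ρ ^ n))))⁻¹ *
            normVol (triangleStrip p f g ρ n) := by gcongr; exact hstrip n
      _ = ∫⁻ x in triangleStrip p f g ρ n,
            (ENNReal.ofReal (κ * (K * (n + 1) * ρ ^ n * (K * ρ ^ n))))⁻¹ ∂normVol := by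
          rw [setLIntegral_const]
      _ ≤ _ := by
          refine setLIntegral_mono' (measurableSet_triangleStrip n) fun x hx => ?_
          rw [ENNReal.inv_le_inv, ← hvol _ _ (by positivity) (by positivity)]
          exact measure_mono (hB n x hx)
  rw [eq_top_iff]
  refine le_trans (le_of_eq ?_) (ENNReal.tsum_le_tsum key)
  by_contra hne
  have hsum := ENNReal.summable_toReal (Ne.symm hne)
  have hc : 0 < d / (κ * K ^ 2) := by positivity
  have : Summable fun n : ℕ => d / (κ * K ^ 2) * ((n + 1 : ℕ) : ℝ)⁻¹ := by
    refine hsum.congr fun n => ?_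
    rw [ENNReal.toReal_ofReal (by positivity)]
  rw [summable_mul_left_iff hc.ne',
    summable_nat_add_iff (f := fun n : ℕ => (n : ℝ)⁻¹) 1] at this
  exact Real.not_summable_natCast_inv this

/-- If the set `B x` attached to a point of the `n`-th strip has area at least of order `8 ^ (-n)`,
then this strip, of area of order `16 ^ (-n)`, contributes at most a multiple of `2 ^ (-n)`. -/
theorem setLIntegral_cornerTriangle_lt_top (hfg : ∀ v, f v = 0 → g v = 0 → v = 0)
    {B : E2 → Set E2} {c : ℝ} (hc : 0 < c)
    (hB : ∀ n : ℕ, ∀ x ∈ triangleStrip p f g (1 / 4) n,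
      ENNReal.ofReal (c * (1 / 8) ^ n) ≤ normVol (B x)) :
    ∫⁻ x in cornerTriangle p f g, (normVol (B x))⁻¹ ∂normVol < ⊤ := by
  obtain ⟨d, hd, hstrip⟩ :=
    exists_normVol_triangleStrip_le (p := p) hfg (ρ := 1 / 4) (by norm_num)
  rw [setLIntegral_cornerTriangle (ρ := 1 / 4) (by norm_num) (by norm_num)]
  have key : ∀ n : ℕ, ∫⁻ x in triangleStrip p f g (1 / 4) n, (normVol (B x))⁻¹ ∂normVol ≤
      ENNReal.ofReal (d / c * (1 / 2) ^ n) := by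
    intro n
    have hA : 0 < c * (1 / 8) ^ n := by positivity
    calc ∫⁻ x in triangleStrip p f g (1 / 4) n, (normVol (B x))⁻¹ ∂normVol
        ≤ ∫⁻ x in triangleStrip p f g (1 / 4) n,
            (ENNReal.ofReal (c * (1 / 8) ^ n))⁻¹ ∂normVol := by
          refine setLIntegral_mono' (measurableSet_triangleStrip n) fun x hx => ?_
          rw [ENNReal.inv_le_inv]
          exact hB n x hx
      _ = (ENNReal.ofReal (c * (1 / 8) ^ n))⁻¹ * normVol (triangleStrip p f g (1 / 4) n) := by
          rw [setLIntegral_const]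
      _ ≤ (ENNReal.ofReal (c * (1 / 8) ^ n))⁻¹ * ENNReal.ofReal (d * ((1 / 4) ^ n) ^ 2) := by
          gcongr; exact hstrip n
      _ = _ := by
          rw [← ENNReal.ofReal_inv_of_pos hA, ← ENNReal.ofReal_mul (inv_nonneg.2 hA.le)]
          congr 1
          have e : ((1 / 4 : ℝ) ^ n) ^ 2 = (1 / 8) ^ n * (1 / 2) ^ n := by
            rw [← pow_mul, mul_comm n 2, pow_mul, ← mul_pow]; norm_num
          rw [e]
          field_simp
  refine (ENNReal.tsum_le_tsum key).trans_lt ?_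
  exact Summable.tsum_ofReal_lt_top (summable_geometric_two.mul_left _)

end Strips

end

section

/-! ### Open convex cones and their traces in an affine chart -/

variable {b : Module.Basis (Fin 3) ℝ (Fin 3 → ℝ)} {C : Set (Fin 3 → ℝ)}

/-- The linear part `v ↦ v₀ b₀ + v₁ b₁` of the affine map `affineVec b`. -/
def affineLin (b : Module.Basis (Fin 3) ℝ (Fin 3 → ℝ)) : E2 →ₗ[ℝ] (Fin 3 → ℝ) where
  toFun v := v 0 • b 0 + v 1 • b 1
  map_add' v w := by simp only [PiLp.add_apply, add_smul]; abel
  map_smul' c v := by simp [mul_smul]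

theorem affineVec_add (x v : E2) : affineVec b (x + v) = affineVec b x + affineLin b v := by
  simp only [affineVec, affineLin, LinearMap.coe_mk, AddHom.coe_mk, PiLp.add_apply, add_smul]
  abel

theorem affineVec_sub (x v : E2) : affineVec b (x - v) = affineVec b x - affineLin b v := by
  rw [sub_eq_add_neg, affineVec_add, map_neg, ← sub_eq_add_neg]

theorem affineLin_sub (x y : E2) :
    affineLin b (x - y) = affineVec b x - affineVec b y := by
  have := affineVec_add (b := b) y (x - y)
  rw [add_sub_cancel] at this
  rw [this, add_sub_cancel_left]

theorem coord_two_affineVec (x : E2) : b.coord 2 (affineVec b x) = 1 := by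
  simp [affineVec]

theorem coord_two_affineLin (v : E2) : b.coord 2 (affineLin b v) = 0 := by
  simp [affineLin]

theorem affineLin_injective : Function.Injective (affineLin b) := by
  rw [injective_iff_map_eq_zero]
  intro v hv
  ext i
  have h := congrArg (fun w => b.repr w (Fin.castSucc i)) hv
  fin_cases i <;> simpa [affineLin] using h

theorem exists_affineVec_eq {v : Fin 3 → ℝ} (hv : b.coord 2 v = 1) :
    ∃ x : E2, affineVec b x = v := by
  refine ⟨!₂[b.repr v 0, b.repr v 1], ?_⟩
  have h := b.sum_repr v
  rw [Fin.sum_univ_three] at h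
  rw [Module.Basis.coord_apply] at hv
  rw [hv, one_smul] at h
  simpa [affineVec] using h

theorem continuous_affineVec : Continuous (affineVec b) := by
  unfold affineVec
  fun_prop

/-- An open convex cone of `ℝ³` whose closure meets the plane `b.coord 2 = 0` only at the origin,
lying on the positive side of that plane. -/
structure IsProperCone (b : Module.Basis (Fin 3) ℝ (Fin 3 → ℝ)) (C : Set (Fin 3 → ℝ)) : Prop where
  isOpen : IsOpen C
  convex : Convex ℝ C
  smul_mem : ∀ {a : ℝ} {v}, 0 < a → v ∈ C → a • v ∈ C
  pos : ∀ {v}, v ∈ C → 0 < b.coord 2 v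
  exists_bound : ∃ m : ℝ, 0 < m ∧ ∀ v ∈ C, m * ‖v‖ ≤ b.coord 2 v

namespace IsProperCone

theorem add_mem (hC : IsProperCone b C) {v w : Fin 3 → ℝ} (hv : v ∈ C) (hw : w ∈ C) :
    v + w ∈ C := by
  have h := hC.smul_mem two_pos (hC.convex hv hw (show (0 : ℝ) ≤ 1 / 2 by norm_num)
    (show (0 : ℝ) ≤ 1 / 2 by norm_num) (by norm_num))
  rwa [smul_add, smul_smul, smul_smul, show (2 : ℝ) * (1 / 2) = 1 by norm_num, one_smul,
    one_smul] at h

theorem add_mem_of_mem_closure (hC : IsProperCone b C) {v w : Fin 3 → ℝ} (hv : v ∈ C)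
    (hw : w ∈ closure C) : v + w ∈ C := by
  have h := hC.convex.combo_interior_closure_mem_interior (x := v) (y := w)
    (by rwa [hC.isOpen.interior_eq]) hw (a := 1 / 2) (b := 1 / 2) (by norm_num)
    (by norm_num) (by norm_num)
  rw [hC.isOpen.interior_eq] at h
  have h := hC.smul_mem two_pos h
  rwa [smul_add, smul_smul, smul_smul, show (2 : ℝ) * (1 / 2) = 1 by norm_num, one_smul,
    one_smul] at h

theorem smul_mem_closure (hC : IsProperCone b C) {a : ℝ} {w : Fin 3 → ℝ} (ha : 0 < a)
    (hw : w ∈ closure C) : a • w ∈ closure C :=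
  map_mem_closure (continuous_const_smul a) hw fun _ h => hC.smul_mem ha h

theorem isOpen_preimage (hC : IsProperCone b C) : IsOpen (affineVec b ⁻¹' C) :=
  hC.isOpen.preimage continuous_affineVec

theorem convex_preimage (hC : IsProperCone b C) : Convex ℝ (affineVec b ⁻¹' C) := by
  intro x hx y hy s t hs ht hst
  have h := hC.convex hx hy hs ht hst
  have e : affineVec b (s • x + t • y) = s • affineVec b x + t • affineVec b y := by
    have h1 : s • x + t • y = x + t • (y - x) := by
      rw [← eq_sub_iff_add_eq] at hst
      rw [hst]; module
    rw [h1, affineVec_add, map_smul, affineLin_sub]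
    rw [← eq_sub_iff_add_eq] at hst
    rw [hst]; module
  change affineVec b _ ∈ C
  rwa [e]

theorem isBounded_preimage (hC : IsProperCone b C) :
    Bornology.IsBounded (affineVec b ⁻¹' C) := by
  obtain ⟨m, hm, hmC⟩ := hC.exists_bound
  let Φ : (Fin 3 → ℝ) → E2 := fun v => !₂[b.coord 0 v, b.coord 1 v]
  have hcont : Continuous Φ := by
    have h0 := (b.coord 0).continuous_of_finiteDimensional
    have h1 := (b.coord 1).continuous_of_finiteDimensional
    refine (PiLp.continuous_toLp 2 _).comp (continuous_pi fun i => ?_)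
    fin_cases i
    · exact h0
    · exact h1
  refine (((isCompact_closedBall (0 : Fin 3 → ℝ) (1 / m)).image hcont).isBounded).subset ?_
  intro x hx
  refine ⟨affineVec b x, ?_, ?_⟩
  · have h := hmC _ hx
    rw [coord_two_affineVec] at h
    rw [mem_closedBall_zero_iff, le_div_iff₀ hm]
    linarith
  · ext i
    fin_cases i <;> simp [Φ, affineVec]

/-- A linear functional that is nonnegative on the cone and not identically zero is positive. -/
theorem pos_of_nonneg (hC : IsProperCone b C) {l : (Fin 3 → ℝ) →ₗ[ℝ] ℝ} (hl : l ≠ 0)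
    (h : ∀ v ∈ C, 0 ≤ l v) {v : Fin 3 → ℝ} (hv : v ∈ C) : 0 < l v := by
  obtain ⟨w, hw⟩ : ∃ w, l w ≠ 0 := by
    by_contra! h0
    exact hl (LinearMap.ext h0)
  have hc : Continuous fun t : ℝ => v - t • w := by fun_prop
  obtain ⟨ε, hε, hball⟩ := Metric.mem_nhds_iff.1
    ((hC.isOpen.preimage hc).mem_nhds (x := 0) (by simpa using hv))
  rcases hw.lt_or_gt with hw | hw
  · have h1 := h _ (hball (show -(ε / 2) ∈ Metric.ball (0 : ℝ) ε by
      rw [mem_ball_zero_iff, norm_neg, Real.norm_of_nonneg (by positivity)]; linarith))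
    rw [map_sub, map_smul, smul_eq_mul] at h1
    nlinarith
  · have h1 := h _ (hball (show ε / 2 ∈ Metric.ball (0 : ℝ) ε by
      rw [mem_ball_zero_iff, Real.norm_of_nonneg (by positivity)]; linarith))
    rw [map_sub, map_smul, smul_eq_mul] at h1
    nlinarith

/-- If rescaled elements `r n • z n` of the cone converge to a multiple `c • e` of a vector, then
either the limit is zero or `c` has the sign of `b.coord 2 e`. -/
theorem eq_zero_or_mul_pos_of_tendsto (hC : IsProperCone b C) {z : ℕ → Fin 3 → ℝ} {r : ℕ → ℝ}
    {c : ℝ} {e : Fin 3 → ℝ} (hz : ∀ n, z n ∈ C) (hr : ∀ᶠ n in Filter.atTop, 0 < r n)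
    (h : Filter.Tendsto (fun n => r n • z n) Filter.atTop (nhds (c • e))) :
    c • e = 0 ∨ 0 < c * b.coord 2 e := by
  obtain ⟨m, hm, hmC⟩ := hC.exists_bound
  have hcont := (b.coord 2).continuous_of_finiteDimensional
  have h1 : m * ‖c • e‖ ≤ b.coord 2 (c • e) := by
    refine le_of_tendsto_of_tendsto (h.norm.const_mul m) ((hcont.tendsto _).comp h) ?_
    filter_upwards [hr] with n hn
    exact hmC _ (hC.smul_mem hn (hz n))
  rw [map_smul, smul_eq_mul] at h1
  refine or_iff_not_imp_left.2 fun h0 => lt_of_lt_of_le ?_ h1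
  exact mul_pos hm (norm_pos_iff.2 h0)

/-- If every orbit, suitably rescaled, converges to the multiple `l v • e` of a fixed vector, then
the functional `l`, with the sign of `b.coord 2 e`, is positive on the cone. -/
theorem mul_pos_of_tendsto (hC : IsProperCone b C) {Z : ℕ → (Fin 3 → ℝ) → Fin 3 → ℝ} {r : ℕ → ℝ}
    {l : (Fin 3 → ℝ) →ₗ[ℝ] ℝ} (hl : l ≠ 0) {e : Fin 3 → ℝ} (he : e ≠ 0)
    (hZ : ∀ n, ∀ v ∈ C, Z n v ∈ C) (hr : ∀ᶠ n in Filter.atTop, 0 < r n)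
    (h : ∀ v, Filter.Tendsto (fun n => r n • Z n v) Filter.atTop (nhds (l v • e)))
    {v : Fin 3 → ℝ} (hv : v ∈ C) : 0 < b.coord 2 e * l v := by
  have key : ∀ w ∈ C, l w = 0 ∨ 0 < l w * b.coord 2 e := by
    intro w hw
    exact (hC.eq_zero_or_mul_pos_of_tendsto (fun n => hZ n w hw) hr (h w)).imp_left
      fun h0 => (smul_eq_zero.1 h0).resolve_right he
  have hne : b.coord 2 e ≠ 0 := by
    intro h0
    have hzero : ∀ w ∈ C, l w = 0 := fun w hw => by simpa [h0] using key w hw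
    exact (hC.pos_of_nonneg hl (fun w hw => (hzero w hw).ge) hv).ne' (hzero v hv)
  have := hC.pos_of_nonneg (l := b.coord 2 e • l) (smul_ne_zero hne hl) (fun w hw => by
    rcases key w hw with h0 | h0
    · simp [h0]
    · rw [LinearMap.smul_apply, smul_eq_mul, mul_comm]; exact h0.le) hv
  simpa using this

/-- A linear functional without zeros on the cone has constant sign there. -/
theorem exists_sign (hC : IsProperCone b C) {l : (Fin 3 → ℝ) →ₗ[ℝ] ℝ}
    (h : ∀ v ∈ C, l v ≠ 0) : ∃ s : ℝ, s ≠ 0 ∧ ∀ v ∈ C, 0 < s * l v := by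
  by_cases hp : ∃ v ∈ C, 0 < l v
  · obtain ⟨v, hv, hlv⟩ := hp
    refine ⟨1, one_ne_zero, fun w hw => ?_⟩
    rw [one_mul]
    by_contra! hlw
    have hlw' := hlw.lt_of_ne (h w hw)
    refine h _ (hC.add_mem (hC.smul_mem (neg_pos.2 hlw') hv) (hC.smul_mem hlv hw)) ?_
    rw [map_add, map_smul, map_smul, smul_eq_mul, smul_eq_mul]
    ring
  · push Not at hp
    refine ⟨-1, by norm_num, fun w hw => ?_⟩
    have := (hp w hw).lt_of_ne (h w hw)
    linarith

end IsProperCone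

/-! ### Peaks in an affine chart -/

/-- The trace in the affine chart of the open simplicial cone spanned by the basis `u`. -/
def peakSet (b u : Module.Basis (Fin 3) ℝ (Fin 3 → ℝ)) : Set E2 :=
  {x | ∀ i, 0 < u.coord i (affineVec b x)}

/-- The Busemann volume of the peak spanned by `u` for the convex set which is the trace of the
cone `C` in the affine chart. -/
def peakVolume (b u : Module.Basis (Fin 3) ℝ (Fin 3 → ℝ)) (C : Set (Fin 3 → ℝ)) : ℝ≥0∞ :=
  ∫⁻ x in peakSet b u, (normVol (finslerBall (affineVec b ⁻¹' C) x))⁻¹ ∂normVol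

section Peak

variable {u : Module.Basis (Fin 3) ℝ (Fin 3 → ℝ)}

theorem sum_coord_eq (hu : ∀ i, b.coord 2 (u i) = 1) (v : Fin 3 → ℝ) :
    u.coord 0 v + u.coord 1 v + u.coord 2 v = b.coord 2 v := by
  conv_rhs => rw [← u.sum_repr v]
  rw [map_sum, Fin.sum_univ_three]
  simp only [map_smul, hu, smul_eq_mul, mul_one, Module.Basis.coord_apply]

theorem coord_affineVec_eq {p : E2} (hp : affineVec b p = u 0) (x : E2) {i : Fin 3}
    (hi : i ≠ 0) : u.coord i (affineVec b x) = (u.coord i ∘ₗ affineLin b) (x - p) := by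
  rw [LinearMap.comp_apply, affineLin_sub, hp, map_sub]
  simp [hi.symm]

theorem peakSet_eq_cornerTriangle (hu : ∀ i, b.coord 2 (u i) = 1) {p : E2}
    (hp : affineVec b p = u 0) :
    peakSet b u = cornerTriangle p (u.coord 1 ∘ₗ affineLin b) (u.coord 2 ∘ₗ affineLin b) := by
  ext x
  have h := sum_coord_eq hu (affineVec b x)
  rw [coord_two_affineVec] at h
  change (∀ i, 0 < u.coord i (affineVec b x)) ↔ (_ ∧ _ ∧ _)
  rw [← coord_affineVec_eq hp x (by decide), ← coord_affineVec_eq hp x (by decide),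
    Fin.forall_fin_succ, Fin.forall_fin_two]
  simp only [Fin.succ_zero_eq_one, Fin.succ_one_eq_two]
  constructor
  · rintro ⟨h0, h1, h2⟩
    exact ⟨h1, h2, by linarith⟩
  · rintro ⟨h1, h2, h3⟩
    exact ⟨by linarith, h1, h2⟩

theorem coord_comp_affineLin_injective (hu : ∀ i, b.coord 2 (u i) = 1) (v : E2)
    (h1 : (u.coord 1 ∘ₗ affineLin b) v = 0) (h2 : (u.coord 2 ∘ₗ affineLin b) v = 0) : v = 0 := by
  have h := sum_coord_eq hu (affineLin b v)
  rw [LinearMap.comp_apply] at h1 h2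
  rw [coord_two_affineLin, h1, h2, add_zero, add_zero] at h
  refine affineLin_injective (b := b) ?_
  rw [map_zero]
  refine u.ext_elem fun i => ?_
  fin_cases i
  · simpa using h
  · simpa using h1
  · simpa using h2

theorem affineVec_eq_combination (x : E2) (hu : ∀ i, b.coord 2 (u i) = 1) {p : E2}
    (hp : affineVec b p = u 0) {s t : ℝ} (hs : s = (u.coord 1 ∘ₗ affineLin b) (x - p))
    (ht : t = (u.coord 2 ∘ₗ affineLin b) (x - p)) :
    affineVec b x = (1 - (s + t)) • u 0 + s • u 1 + t • u 2 := by
  rw [← coord_affineVec_eq hp x (by decide)] at hs ht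
  have h := sum_coord_eq hu (affineVec b x)
  rw [coord_two_affineVec, ← hs, ← ht] at h
  conv_lhs => rw [← u.sum_repr (affineVec b x)]
  rw [Fin.sum_univ_three]
  simp only [Module.Basis.coord_apply] at h hs ht
  rw [← hs, ← ht, show (1 - (s + t)) = u.repr (affineVec b x) 0 by linarith]

/-- A peak has infinite volume as soon as, near its vertex, the convex set is trapped in a region
only logarithmically wider than a sector: `l₂` is positive on the cone, both functionals vanish at
the vertex, and `l₁` satisfies a family of lower bounds. At height `l₂ ~ ρ ^ n` the unit ball of the
Finsler norm lies in a box with sides of size `n ρ ^ n` and `ρ ^ n`, and the harmonic series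
diverges. -/
theorem peakVolume_eq_top_of_growth (hC : IsProperCone b C) (hu : ∀ i, b.coord 2 (u i) = 1)
    (hu1 : u 1 ∈ C) (hu2 : u 2 ∈ C) (hu0 : u 0 ∈ closure C)
    {l₁ l₂ : (Fin 3 → ℝ) →ₗ[ℝ] ℝ}
    (h10 : l₁ (u 0) = 0) (h20 : l₂ (u 0) = 0)
    (hker : ∀ v, l₁ v = 0 → l₂ v = 0 → ∃ a : ℝ, v = a • u 0)
    (hpos : ∀ v ∈ C, 0 < l₂ v) {ρ K : ℝ} (hρ0 : 0 < ρ) (hρ1 : ρ < 1) (hK : 0 < K)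
    (hgrowth : ∀ n : ℕ, ∀ v ∈ C, -(K * ((n + 1) * l₂ v + ρ ^ n * b.coord 2 v)) ≤ l₁ v) :
    peakVolume b u C = ⊤ := by
  obtain ⟨p, hp⟩ := exists_affineVec_eq (hu 0)
  rw [peakVolume, peakSet_eq_cornerTriangle hu hp]
  let M : ℝ := 1 + l₂ (u 1) + l₂ (u 2) + |l₁ (u 1)| + |l₁ (u 2)|
  have hl1 := hpos _ hu1
  have hl2 := hpos _ hu2
  have ha1 := abs_nonneg (l₁ (u 1))
  have ha2 := abs_nonneg (l₁ (u 2))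
  have hM : 0 < M := by positivity
  refine setLIntegral_cornerTriangle_eq_top (coord_comp_affineLin_injective hu) hρ0 hρ1
    (F₁ := l₁ ∘ₗ affineLin b) (F₂ := l₂ ∘ₗ affineLin b) ?_
    (K := M + K * (2 * M) + K + 1) (by positivity) ?_
  · intro v h1 h2
    obtain ⟨a, ha⟩ := hker _ h1 h2
    have h := coord_two_affineLin (b := b) v
    rw [ha, map_smul, hu, smul_eq_mul, mul_one] at h
    refine affineLin_injective (b := b) ?_
    rw [ha, h, zero_smul, map_zero]
  · intro n x hx v hv
    obtain ⟨⟨hs0, ht0, hst1⟩, -, hstn⟩ := hx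
    have hρn : 0 < ρ ^ n := pow_pos hρ0 n
    set s := (u.coord 1 ∘ₗ affineLin b) (x - p) with hs
    set t := (u.coord 2 ∘ₗ affineLin b) (x - p) with ht
    have hw := affineVec_eq_combination x hu hp hs ht
    have hxC : x ∈ affineVec b ⁻¹' C := by
      change affineVec b x ∈ C
      rw [hw, add_assoc, add_comm]
      exact hC.add_mem_of_mem_closure (hC.add_mem (hC.smul_mem hs0 hu1) (hC.smul_mem ht0 hu2))
        (hC.smul_mem_closure (by linarith) hu0)
    obtain ⟨hvp, hvm⟩ := mem_of_mem_finslerBall hC.isBounded_preimage hC.isOpen_preimage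
      hC.convex_preimage hxC hv
    rw [Set.mem_preimage, affineVec_add] at hvp
    rw [Set.mem_preimage, affineVec_sub] at hvm
    have e2 : l₂ (affineVec b x) = s * l₂ (u 1) + t * l₂ (u 2) := by
      rw [hw]; simp [h20]
    have e1 : l₁ (affineVec b x) = s * l₁ (u 1) + t * l₁ (u 2) := by
      rw [hw]; simp [h10]
    have b2 : l₂ (affineVec b x) ≤ M * ρ ^ n := by
      rw [e2]
      have : s * l₂ (u 1) + t * l₂ (u 2) ≤ s * M + t * M := by
        gcongr <;> linarith
      nlinarith
    have b1 : l₁ (affineVec b x) ≤ M * ρ ^ n := by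
      rw [e1]
      have : s * l₁ (u 1) + t * l₁ (u 2) ≤ s * M + t * M := by
        gcongr
        · linarith [le_abs_self (l₁ (u 1))]
        · linarith [le_abs_self (l₁ (u 2))]
      nlinarith
    have p2 := hpos _ hvp
    have m2 := hpos _ hvm
    have gp := hgrowth n _ hvp
    have gm := hgrowth n _ hvm
    rw [map_add] at p2
    rw [map_sub] at m2
    simp only [map_add, map_sub, coord_two_affineVec, coord_two_affineLin, add_zero,
      sub_zero, mul_one] at gp gm
    set y := l₂ (affineVec b x)
    set d := l₂ (affineLin b v)
    set z := l₁ (affineVec b x)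
    set c := l₁ (affineLin b v)
    have hn : (1 : ℝ) ≤ n + 1 := by linarith [Nat.cast_nonneg (α := ℝ) n]
    have hn0 : (0 : ℝ) ≤ n := Nat.cast_nonneg n
    have q1 : K * ((n + 1) * (y + d)) ≤ K * ((n + 1) * (2 * (M * ρ ^ n))) := by
      gcongr; linarith
    have q2 : K * ((n + 1) * (y - d)) ≤ K * ((n + 1) * (2 * (M * ρ ^ n))) := by
      gcongr; linarith
    have r1 : M * ρ ^ n ≤ M * (n + 1) * ρ ^ n := by
      gcongr; exact le_mul_of_one_le_right hM.le hn
    have r2 : K * ρ ^ n ≤ K * (n + 1) * ρ ^ n := by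
      gcongr; exact le_mul_of_one_le_right hK.le hn
    have r3 : 0 < (n + 1) * ρ ^ n := by positivity
    have r4 : 0 < K * M * ρ ^ n := by positivity
    have r5 : 0 < K * ρ ^ n := by positivity
    constructor
    · rw [LinearMap.comp_apply, abs_lt]
      constructor <;> linarith
    · rw [LinearMap.comp_apply, abs_lt]
      constructor <;> linarith

/-- A peak whose vertex is a corner, that is, a point with two distinct supporting lines, has
infinite volume. -/
theorem peakVolume_eq_top_of_corner (hC : IsProperCone b C) (hu : ∀ i, b.coord 2 (u i) = 1)
    (hu1 : u 1 ∈ C) (hu2 : u 2 ∈ C) (hu0 : u 0 ∈ closure C)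
    {l₁ l₂ : (Fin 3 → ℝ) →ₗ[ℝ] ℝ}
    (h10 : l₁ (u 0) = 0) (h20 : l₂ (u 0) = 0)
    (hker : ∀ v, l₁ v = 0 → l₂ v = 0 → ∃ a : ℝ, v = a • u 0)
    (hpos₁ : ∀ v ∈ C, 0 < l₁ v) (hpos₂ : ∀ v ∈ C, 0 < l₂ v) :
    peakVolume b u C = ⊤ := by
  refine peakVolume_eq_top_of_growth hC hu hu1 hu2 hu0 h10 h20 hker hpos₂ (ρ := 1 / 2) (K := 1)
    (by norm_num) (by norm_num) one_pos fun n v hv => ?_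
  have h1 := hpos₁ v hv
  have h2 := hpos₂ v hv
  have h3 := hC.pos hv
  have : 0 < 1 * ((n + 1) * l₂ v + (1 / 2) ^ n * b.coord 2 v) := by positivity
  linarith

end Peak

end

section

/-! ### The cone over a properly convex open set -/

variable {b : Module.Basis (Fin 3) ℝ (Fin 3 → ℝ)} {Ω : Set Plane}

theorem isOpen_lift {O : Set Plane} (hO : IsOpen O) :
    IsOpen {v : Fin 3 → ℝ | ∃ h, Projectivization.mk ℝ v h ∈ O} := by
  have h1 : IsOpen {v : Fin 3 → ℝ | v ≠ 0} := isOpen_ne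
  have h2 : IsOpen ((fun v : {v : Fin 3 → ℝ // v ≠ 0} => Projectivization.mk ℝ v.1 v.2) ⁻¹' O) :=
    isOpen_coinduced.1 hO
  have h3 := h1.isOpenMap_subtype_val _ h2
  convert h3 using 1
  ext v
  constructor
  · rintro ⟨h, hv⟩
    exact ⟨⟨v, h⟩, hv, rfl⟩
  · rintro ⟨⟨w, hw⟩, hv, rfl⟩
    exact ⟨hw, hv⟩

/-- A set of points of the plane defined by a scaling-invariant open condition on representatives
is open. -/
theorem isOpen_of_isOpen_rep {s : Set (Fin 3 → ℝ)} (hs : IsOpen s)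
    (hinv : ∀ (a : ℝ) (v), a ≠ 0 → v ∈ s → a • v ∈ s) : IsOpen {x : Plane | x.rep ∈ s} := by
  refine isOpen_coinduced.2 ?_
  convert hs.preimage (continuous_subtype_val (p := fun v : Fin 3 → ℝ => v ≠ 0)) using 1
  ext ⟨v, hv⟩
  obtain ⟨a, ha⟩ := Projectivization.exists_smul_eq_mk_rep ℝ v hv
  change (Projectivization.mk ℝ v hv).rep ∈ s ↔ v ∈ s
  rw [← ha]
  refine ⟨fun h => ?_, fun h => hinv a v a.ne_zero h⟩
  have := hinv (a⁻¹ : ℝˣ) _ (Units.ne_zero _) h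
  rwa [Units.smul_def, smul_smul, Units.inv_mul, one_smul] at this

theorem mk_smul_eq {a : ℝ} {v : Fin 3 → ℝ} (hv : v ≠ 0) (h : a • v ≠ 0) :
    Projectivization.mk ℝ (a • v) h = Projectivization.mk ℝ v hv := by
  rw [Projectivization.mk_eq_mk_iff']
  exact ⟨a, rfl⟩

theorem mk_mem_closure {v : Fin 3 → ℝ} (hv : v ≠ 0)
    (h : v ∈ closure {v : Fin 3 → ℝ | ∃ h, Projectivization.mk ℝ v h ∈ Ω}) :
    Projectivization.mk ℝ v hv ∈ closure Ω := by
  rw [mem_closure_iff]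
  intro O hO hvO
  obtain ⟨w, ⟨h1, h2⟩, h3, h4⟩ := mem_closure_iff.1 h _ (isOpen_lift hO) ⟨hv, hvO⟩
  exact ⟨_, h2, h4⟩

/-- The cone in `ℝ³` of the representatives, positive for `b.coord 2`, of the points of `Ω`. -/
def coneOver (b : Module.Basis (Fin 3) ℝ (Fin 3 → ℝ)) (Ω : Set Plane) : Set (Fin 3 → ℝ) :=
  {v | 0 < b.coord 2 v ∧ ∃ h, Projectivization.mk ℝ v h ∈ Ω}

theorem affineVec_mem_coneOver (x : E2) : affineVec b x ∈ coneOver b Ω ↔ affineChart b x ∈ Ω := by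
  constructor
  · rintro ⟨-, h, hx⟩
    exact hx
  · intro h
    exact ⟨by rw [coord_two_affineVec]; exact one_pos, affineVec_ne_zero b x, h⟩

theorem smul_mem_coneOver {a : ℝ} {v : Fin 3 → ℝ} (ha : 0 < a) (hv : v ∈ coneOver b Ω) :
    a • v ∈ coneOver b Ω := by
  obtain ⟨h1, h2, h3⟩ := hv
  refine ⟨by rw [map_smul, smul_eq_mul]; positivity, smul_ne_zero ha.ne' h2, ?_⟩
  rwa [mk_smul_eq h2]

theorem isOpen_coneOver (hΩ : IsOpen Ω) : IsOpen (coneOver b Ω) :=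
  (isOpen_lt continuous_const (b.coord 2).continuous_of_finiteDimensional).inter (isOpen_lift hΩ)

theorem coord_two_ne_zero (hb : closure Ω ⊆ Set.range (affineChart b)) {v : Fin 3 → ℝ}
    (hv : v ≠ 0) (h : Projectivization.mk ℝ v hv ∈ closure Ω) : b.coord 2 v ≠ 0 := by
  obtain ⟨x, hx⟩ := hb h
  rw [affineChart, Projectivization.mk_eq_mk_iff'] at hx
  obtain ⟨a, ha⟩ := hx
  intro h0
  have := coord_two_affineVec (b := b) x
  rw [← ha, map_smul, h0, smul_zero] at this
  exact zero_ne_one this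

theorem mem_coneOver_or_neg_mem (hb : closure Ω ⊆ Set.range (affineChart b)) {v : Fin 3 → ℝ}
    (hv : v ≠ 0) (h : Projectivization.mk ℝ v hv ∈ Ω) :
    v ∈ coneOver b Ω ∨ -v ∈ coneOver b Ω := by
  rcases (coord_two_ne_zero hb hv (subset_closure h)).lt_or_gt with h0 | h0
  · refine Or.inr ⟨by rw [map_neg]; linarith, neg_ne_zero.2 hv, ?_⟩
    have := mk_smul_eq (a := -1) hv (by simpa using hv)
    simp only [neg_smul, one_smul] at this
    rwa [this]
  · exact Or.inl ⟨h0, hv, h⟩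

/-- The segment between two representatives with `b.coord 2 = 1` stays in the cone: otherwise the
missing point would disconnect the trace of `Ω` on the line through the two points. -/
theorem combo_mem_coneOver (hb : closure Ω ⊆ Set.range (affineChart b)) (hconv : IsProjConvex Ω)
    {v w : Fin 3 → ℝ} (hv : v ∈ coneOver b Ω) (hw : w ∈ coneOver b Ω)
    (hv1 : b.coord 2 v = 1) (hw1 : b.coord 2 w = 1) {t : ℝ} (ht0 : 0 < t) (ht1 : t < 1) :
    (1 - t) • v + t • w ∈ coneOver b Ω := by
  by_cases hvw : v = w
  · rw [hvw, ← add_smul, sub_add_cancel, one_smul]; exact hw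
  have hli : LinearIndependent ℝ ![v, w] := by
    rw [LinearIndependent.pair_iff]
    intro s r h
    have h1 := congrArg (b.coord 2) h
    simp only [map_add, map_smul, hv1, hw1, smul_eq_mul, mul_one, map_zero] at h1
    have hr : r = -s := by linarith
    subst hr
    have h2 : s • (v - w) = 0 := by rw [← h]; module
    have h3 := (smul_eq_zero.1 h2).resolve_right (sub_ne_zero.2 hvw)
    simp [h3]
  obtain ⟨l, hlv, hlw⟩ : ∃ l : (Fin 3 → ℝ) →ₗ[ℝ] ℝ, l v = 0 ∧ l w = 1 := by
    obtain ⟨l, hl⟩ := LinearMap.exists_extend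
      (((Module.Basis.span hli).constr ℝ ![(0 : ℝ), 1] : _ →ₗ[ℝ] ℝ))
    have key : ∀ i, l (![v, w] i) = ![(0 : ℝ), 1] i := fun i => by
      have h1 := LinearMap.congr_fun hl (Module.Basis.span hli i)
      rw [Module.Basis.constr_basis, LinearMap.comp_apply, Submodule.subtype_apply,
        Module.Basis.span_apply] at h1
      exact h1
    exact ⟨l, key 0, key 1⟩
  let L : Submodule ℝ (Fin 3 → ℝ) := Submodule.span ℝ (Set.range ![v, w])
  have hL : Module.finrank ℝ L = 2 := by
    rw [finrank_span_eq_card hli, Fintype.card_fin]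
  have hvL : v ∈ L := Submodule.subset_span ⟨0, rfl⟩
  have hwL : w ∈ L := Submodule.subset_span ⟨1, rfl⟩
  have hline : ∀ {z : Fin 3 → ℝ} (hz : z ≠ 0), z ∈ L → Projectivization.mk ℝ z hz ∈ projLine L := by
    intro z hz hzL
    change (Projectivization.mk ℝ z hz).submodule ≤ L
    rw [Projectivization.submodule_mk, Submodule.span_singleton_le_iff_mem]
    exact hzL
  -- `q` has the sign of the affine parameter minus `t` on the line
  let q : (Fin 3 → ℝ) → ℝ := fun z => (l z - t * b.coord 2 z) * b.coord 2 z
  have hqc : Continuous q := by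
    have h0 := l.continuous_of_finiteDimensional
    have h1 := (b.coord 2).continuous_of_finiteDimensional
    fun_prop
  have hqs : ∀ (a : ℝ) z, q (a • z) = a ^ 2 * q z := by
    intro a z
    simp only [q, map_smul, smul_eq_mul]
    ring
  have hA : IsOpen {x : Plane | x.rep ∈ {z | q z < 0}} :=
    isOpen_of_isOpen_rep (isOpen_lt hqc continuous_const) fun a z ha hz => by
      change q _ < 0
      rw [hqs]
      exact mul_neg_of_pos_of_neg (by positivity) hz
  have hB : IsOpen {x : Plane | x.rep ∈ {z | 0 < q z}} :=
    isOpen_of_isOpen_rep (isOpen_lt continuous_const hqc) fun a z ha hz => by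
      change 0 < q _
      rw [hqs]
      exact mul_pos (by positivity) hz
  have hrep : ∀ (z : Fin 3 → ℝ) (hz : z ≠ 0),
      ∃ a : ℝ, a ≠ 0 ∧ (Projectivization.mk ℝ z hz).rep = a • z := by
    intro z hz
    obtain ⟨a, ha⟩ := Projectivization.exists_smul_eq_mk_rep ℝ z hz
    exact ⟨a, a.ne_zero, ha.symm⟩
  by_contra hmem
  have hpre := hconv L hL _ _ hA hB ?_ ?_ ?_
  · obtain ⟨x, -, hx1, hx2⟩ := hpre
    exact lt_asymm (show q x.rep < 0 from hx1) hx2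
  · rintro x ⟨hxΩ, hxL⟩
    have hx0 := x.rep_nonzero
    rw [← x.mk_rep] at hxΩ hxL
    have hφ := coord_two_ne_zero hb hx0 (subset_closure hxΩ)
    have hzL : x.rep ∈ L := by
      change (Projectivization.mk ℝ x.rep hx0).submodule ≤ L at hxL
      rwa [Projectivization.submodule_mk, Submodule.span_singleton_le_iff_mem] at hxL
    rcases lt_trichotomy (q x.rep) 0 with h | h | h
    · exact Or.inl h
    · exfalso
      have h1 : l x.rep = t * b.coord 2 x.rep :=
        sub_eq_zero.1 ((mul_eq_zero.1 h).resolve_right hφ)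
      have hzL' : x.rep ∈ Submodule.span ℝ {v, w} := by
        have : Set.range ![v, w] = {v, w} := by
          rw [Set.pair_comm]; simp
        rwa [← this]
      obtain ⟨c, d, hcd⟩ := Submodule.mem_span_pair.1 hzL'
      have h2 : d = t * b.coord 2 x.rep := by
        rw [← h1, ← hcd]; simp [hlv, hlw]
      have h3 : c + d = b.coord 2 x.rep := by
        rw [← hcd, map_add, map_smul, map_smul, hv1, hw1]; simp
      have h4 : x.rep = b.coord 2 x.rep • ((1 - t) • v + t • w) := by
        conv_lhs => rw [← hcd]
        have : c = b.coord 2 x.rep * (1 - t) := by linarith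
        rw [this, h2]; module
      set z := (1 - t) • v + t • w with hz
      have hz1 : b.coord 2 z = 1 := by
        rw [hz, map_add, map_smul, map_smul, hv1, hw1]; simp
      have hz0 : z ≠ 0 := by
        intro h0
        rw [h0, map_zero] at hz1
        exact zero_ne_one hz1
      refine hmem ⟨by rw [hz1]; exact one_pos, hz0, ?_⟩
      have h5 : Projectivization.mk ℝ x.rep hx0 = Projectivization.mk ℝ z hz0 := by
        rw [Projectivization.mk_eq_mk_iff']
        exact ⟨_, h4.symm⟩
      rwa [← h5]
    · exact Or.inr h
  · obtain ⟨-, h0, hΩ⟩ := hv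
    obtain ⟨a, ha, har⟩ := hrep v h0
    refine ⟨_, ⟨hΩ, hline h0 hvL⟩, ?_⟩
    change q _ < 0
    rw [har, hqs]
    refine mul_neg_of_pos_of_neg (by positivity) ?_
    simp only [q, hlv, hv1]
    linarith
  · obtain ⟨-, h0, hΩ⟩ := hw
    obtain ⟨a, ha, har⟩ := hrep w h0
    refine ⟨_, ⟨hΩ, hline h0 hwL⟩, ?_⟩
    change 0 < q _
    rw [har, hqs]
    refine mul_pos (by positivity) ?_
    simp only [q, hlw, hw1]
    linarith

theorem convex_coneOver (hb : closure Ω ⊆ Set.range (affineChart b)) (hconv : IsProjConvex Ω) :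
    Convex ℝ (coneOver b Ω) := by
  rw [convex_iff_forall_pos]
  intro v hv w hw s t hs ht hst
  have hφv := hv.1
  have hφw := hw.1
  set α := b.coord 2 v
  set β := b.coord 2 w
  have hα : 0 < s * α := by positivity
  have hβ : 0 < t * β := by positivity
  have h := combo_mem_coneOver hb hconv (smul_mem_coneOver (inv_pos.2 hφv) hv)
    (smul_mem_coneOver (inv_pos.2 hφw) hw)
    (by rw [map_smul, smul_eq_mul]; exact inv_mul_cancel₀ hφv.ne')
    (by rw [map_smul, smul_eq_mul]; exact inv_mul_cancel₀ hφw.ne')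
    (t := t * β / (s * α + t * β)) (by positivity) (by rw [div_lt_one (by positivity)]; linarith)
  have h2 := smul_mem_coneOver (a := s * α + t * β) (by positivity) h
  convert h2 using 1
  rw [smul_add, smul_smul, smul_smul, smul_smul, smul_smul]
  congr 2 <;> field_simp
  ring

theorem isProperCone_coneOver (hΩ : IsOpen Ω) (hconv : IsProjConvex Ω)
    (hb : closure Ω ⊆ Set.range (affineChart b)) : IsProperCone b (coneOver b Ω) where
  isOpen := isOpen_coneOver hΩ
  convex := convex_coneOver hb hconv
  smul_mem := smul_mem_coneOver
  pos h := h.1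
  exists_bound := by
    have hc := (b.coord 2).continuous_of_finiteDimensional
    have hK : IsCompact (Metric.sphere (0 : Fin 3 → ℝ) 1 ∩ closure (coneOver b Ω)) :=
      (isCompact_sphere _ _).inter_right isClosed_closure
    have hpos : ∀ v ∈ Metric.sphere (0 : Fin 3 → ℝ) 1 ∩ closure (coneOver b Ω),
        0 < b.coord 2 v := by
      rintro v ⟨hv1, hvC⟩
      have hv : v ≠ 0 := by
        rintro rfl
        simp at hv1
      have h1 : b.coord 2 v ≠ 0 :=
        coord_two_ne_zero hb hv (mk_mem_closure hv (closure_mono (fun w hw => hw.2) hvC))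
      have h2 : 0 ≤ b.coord 2 v :=
        closure_minimal (fun w hw => (hw.1 : 0 < b.coord 2 w).le)
          (isClosed_le continuous_const hc) hvC
      exact h2.lt_of_ne h1.symm
    obtain ⟨m, hm, hmK⟩ := hK.exists_forall_le' hc.continuousOn hpos
    refine ⟨m, hm, fun v hv => ?_⟩
    have h0 : 0 < ‖v‖ := norm_pos_iff.2 hv.2.1
    have h := hmK (‖v‖⁻¹ • v) ⟨by
      rw [mem_sphere_zero_iff_norm, norm_smul, norm_inv, norm_norm, inv_mul_cancel₀ h0.ne'],
      subset_closure (smul_mem_coneOver (inv_pos.2 h0) hv)⟩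
    rw [map_smul, smul_eq_mul, ← div_eq_inv_mul, le_div_iff₀ h0] at h
    exact h

/-- The data of a peak, read in the cone over `Ω`: the vertices have representatives on the plane
`b.coord 2 = 1`, and the trace of the peak in the chart is the triangle that they span. -/
theorem IsPeak.exists_basis {P : Set Plane} {p : Plane} (hΩ : IsOpen Ω)
    (hb : closure Ω ⊆ Set.range (affineChart b)) (hP : IsPeak Ω p P) :
    ∃ u : Module.Basis (Fin 3) ℝ (Fin 3 → ℝ), (∀ i, b.coord 2 (u i) = 1) ∧
      u 0 ∈ closure (coneOver b Ω) ∧ u 1 ∈ coneOver b Ω ∧ u 2 ∈ coneOver b Ω ∧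
      p = Projectivization.mk ℝ (u 0) (u.ne_zero 0) ∧
      busemannVolume b Ω P = peakVolume b u (coneOver b Ω) := by
  obtain ⟨hPΩ, q, r, ⟨u, hli, ⟨h0, hp⟩, ⟨h1, hq⟩, ⟨h2, hr⟩, hT⟩, hpf, hqf, hrf⟩ := hP
  have hφc := (b.coord 2).continuous_of_finiteDimensional
  have hcomb : ∀ {c : Fin 3 → ℝ}, (∀ i, 0 < c i) → ∑ i, c i • u i ≠ 0 := by
    intro c hc h
    exact (hc 0).ne' (Fintype.linearIndependent_iff.1 hli c h 0)
  have hmemΩ : ∀ {c : Fin 3 → ℝ} (hc : ∀ i, 0 < c i),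
      Projectivization.mk ℝ (∑ i, c i • u i) (hcomb hc) ∈ Ω := by
    intro c hc
    refine hPΩ ?_
    rw [hT]
    have e := Fin.sum_univ_three fun i => c i • u i
    exact ⟨c 0, c 1, c 2, hc 0, hc 1, hc 2, by rw [← e]; exact hcomb hc, by congr 1⟩
  -- the sign of `b.coord 2` on the simplicial cone
  obtain ⟨σ, hσ, hσpos⟩ : ∃ σ : ℝ, σ ≠ 0 ∧ ∀ c : Fin 3 → ℝ, (∀ i, 0 < c i) →
      0 < σ * b.coord 2 (∑ i, c i • u i) := by
    have hne : ∀ c : Fin 3 → ℝ, (∀ i, 0 < c i) → b.coord 2 (∑ i, c i • u i) ≠ 0 :=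
      fun c hc => coord_two_ne_zero hb (hcomb hc) (subset_closure (hmemΩ hc))
    refine ⟨b.coord 2 (∑ i, (1 : ℝ) • u i), hne (fun _ => 1) fun _ => one_pos, fun c hc => ?_⟩
    by_contra! hle
    have h1 := hne (fun _ => 1) fun _ => one_pos
    have h2 := hne c hc
    set y := b.coord 2 (∑ i, (1 : ℝ) • u i)
    set z := b.coord 2 (∑ i, c i • u i)
    have hyz : 0 < -(y * z) := by
      have : y * z ≠ 0 := mul_ne_zero h1 h2
      rcases hle.lt_or_eq with h | h
      · linarith
      · exact absurd h this
    have hy2 : 0 < y ^ 2 := by positivity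
    have h3 := hne (fun i => -(y * z) + y ^ 2 * c i) fun i => by
      have := hc i
      positivity
    refine h3 ?_
    have : ∑ i, (-(y * z) + y ^ 2 * c i) • u i =
        -(y * z) • (∑ i, (1 : ℝ) • u i) + y ^ 2 • (∑ i, c i • u i) := by
      simp only [Finset.smul_sum, ← Finset.sum_add_distrib, smul_smul, add_smul, mul_one]
    rw [this, map_add, map_smul, map_smul]
    simp only [smul_eq_mul]
    change -(y * z) * y + y ^ 2 * z = 0
    ring
  let s : (Fin 3 → ℝ) := ∑ i, (1 : ℝ) • u i
  have hcl : ∀ i, σ • u i ∈ closure (coneOver b Ω) := by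
    intro i
    have ht : Filter.Tendsto (fun ε : ℝ => σ • (u i + ε • s)) (nhdsWithin 0 (Set.Ioi 0))
        (nhds (σ • u i)) := by
      have hc : Continuous fun ε : ℝ => σ • (u i + ε • s) := by fun_prop
      have := (hc.tendsto 0).mono_left (nhdsWithin_le_nhds (s := Set.Ioi 0))
      simpa using this
    refine mem_closure_of_tendsto ht ?_
    filter_upwards [self_mem_nhdsWithin] with ε hε
    have hε : 0 < ε := hε
    let c : Fin 3 → ℝ := fun j => (if j = i then 1 else 0) + ε
    have hc : ∀ j, 0 < c j := by
      intro j
      simp only [c]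
      split_ifs <;> linarith
    have e : u i + ε • s = ∑ j, c j • u j := by
      simp only [s, c, add_smul, Finset.sum_add_distrib, Finset.smul_sum, one_smul, ite_smul,
        zero_smul, Finset.sum_ite_eq', Finset.mem_univ, if_true]
    rw [e]
    refine ⟨by rw [map_smul, smul_eq_mul]; exact hσpos c hc, smul_ne_zero hσ (hcomb hc), ?_⟩
    rw [mk_smul_eq (hcomb hc)]
    exact hmemΩ hc
  have hmkcl : ∀ i, Projectivization.mk ℝ (u i) (hli.ne_zero i) ∈ closure Ω := by
    intro i
    rw [← mk_smul_eq (hli.ne_zero i) (smul_ne_zero hσ (hli.ne_zero i))]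
    exact mk_mem_closure _ (closure_mono (fun w hw => hw.2) (hcl i))
  have hφpos : ∀ i, 0 < σ * b.coord 2 (u i) := by
    intro i
    have h1 : 0 ≤ b.coord 2 (σ • u i) := closure_minimal
      (fun w hw => (hw.1 : 0 < b.coord 2 w).le) (isClosed_le continuous_const hφc) (hcl i)
    rw [map_smul, smul_eq_mul] at h1
    exact h1.lt_of_ne (mul_ne_zero hσ (coord_two_ne_zero hb (hli.ne_zero i) (hmkcl i))).symm
  have hφne : ∀ i, b.coord 2 (u i) ≠ 0 := fun i => right_ne_zero_of_mul (hφpos i).ne'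
  let w : Fin 3 → ℝˣ := fun i => Units.mk0 (b.coord 2 (u i))⁻¹ (inv_ne_zero (hφne i))
  let B := basisOfLinearIndependentOfCardEqFinrank (hli.units_smul w) (by simp)
  have hB : ∀ i, B i = (b.coord 2 (u i))⁻¹ • u i := by
    intro i
    simp only [B, coe_basisOfLinearIndependentOfCardEqFinrank]
    rfl
  have hBσ : ∀ i, B i = (σ * b.coord 2 (u i))⁻¹ • (σ • u i) := by
    intro i
    rw [hB, smul_smul, mul_inv, mul_right_comm, inv_mul_cancel₀ hσ, one_mul]
  have hB1 : ∀ i, b.coord 2 (B i) = 1 := fun i => by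
    rw [hB, map_smul, smul_eq_mul, inv_mul_cancel₀ (hφne i)]
  have hmkB : ∀ i, Projectivization.mk ℝ (B i) (B.ne_zero i) =
      Projectivization.mk ℝ (u i) (hli.ne_zero i) := by
    intro i
    rw [Projectivization.mk_eq_mk_iff']
    exact ⟨_, (hB i).symm⟩
  have hmem : ∀ i, Projectivization.mk ℝ (u i) (hli.ne_zero i) ∉ frontier Ω →
      B i ∈ coneOver b Ω := by
    intro i hi
    refine ⟨by rw [hB1]; exact one_pos, B.ne_zero i, ?_⟩
    rw [hmkB]
    by_contra hn
    exact hi (by rw [hΩ.frontier_eq]; exact ⟨hmkcl i, hn⟩)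
  refine ⟨B, hB1, ?_, hmem 1 (hq ▸ hqf), hmem 2 (hr ▸ hrf), by rw [hmkB, hp], ?_⟩
  · rw [hBσ]
    exact map_mem_closure (continuous_const_smul _) (hcl 0)
      fun _ h => smul_mem_coneOver (inv_pos.2 (hφpos 0)) h
  · have hU : affineChart b ⁻¹' Ω = affineVec b ⁻¹' coneOver b Ω := by
      ext x
      exact (affineVec_mem_coneOver x).symm
    have hPset : affineChart b ⁻¹' P = peakSet b B := by
      ext x
      have hsum := B.sum_repr (affineVec b x)
      rw [Set.mem_preimage, hT]
      constructor
      · rintro ⟨c0, c1, c2, hc0, hc1, hc2, hne, heq⟩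
        rw [affineChart, Projectivization.mk_eq_mk_iff'] at heq
        obtain ⟨a, ha⟩ := heq
        let c : Fin 3 → ℝ := ![c0, c1, c2]
        have hc : ∀ i, 0 < c i := by
          intro i; fin_cases i <;> assumption
        have e : c0 • u 0 + c1 • u 1 + c2 • u 2 = ∑ i, c i • u i := by
          rw [Fin.sum_univ_three]; rfl
        have hσc := hσpos c hc
        have h1 := coord_two_affineVec (b := b) x
        rw [← ha, e, map_smul, smul_eq_mul] at h1
        have haσ : 0 < a * σ⁻¹ := by
          have h2 : a * σ⁻¹ * (σ * b.coord 2 (∑ i, c i • u i)) = 1 := by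
            rw [← h1]; field_simp
          by_contra! h3
          linarith [mul_nonpos_of_nonpos_of_nonneg h3 hσc.le]
        intro i
        have h4 : affineVec b x = ∑ i, (a * c i * b.coord 2 (u i)) • B i := by
          rw [← ha, e, Finset.smul_sum]
          refine Finset.sum_congr rfl fun i _ => ?_
          rw [hB, smul_smul, smul_smul, mul_inv_cancel_right₀ (hφne i)]
        rw [h4, Module.Basis.coord_apply, B.repr_sum_self]
        have h5 : a * c i * b.coord 2 (u i) = a * σ⁻¹ * (c i * (σ * b.coord 2 (u i))) := by
          field_simp
        change 0 < a * c i * b.coord 2 (u i)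
        rw [h5]
        exact mul_pos haσ (mul_pos (hc i) (hφpos i))
      · intro hx
        let c : Fin 3 → ℝ := fun i => B.coord i (affineVec b x) * (σ * b.coord 2 (u i))⁻¹
        have hc : ∀ i, 0 < c i := fun i => mul_pos (hx i) (inv_pos.2 (hφpos i))
        have e : c 0 • u 0 + c 1 • u 1 + c 2 • u 2 = ∑ i, c i • u i := by
          rw [Fin.sum_univ_three]
        refine ⟨c 0, c 1, c 2, hc 0, hc 1, hc 2, by rw [e]; exact hcomb hc, ?_⟩
        rw [affineChart, Projectivization.mk_eq_mk_iff']
        refine ⟨σ, ?_⟩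
        rw [e, Finset.smul_sum, ← hsum]
        refine Finset.sum_congr rfl fun i _ => ?_
        rw [hBσ, smul_comm σ (c i), smul_smul]
        simp only [c, Module.Basis.coord_apply, smul_smul, mul_assoc]
    rw [busemannVolume, peakVolume, hU, hPset]

theorem mk_mulVec_mem {γ : SL(3, ℝ)} (hγ : γ ∈ Aut Ω) {v : Fin 3 → ℝ} (hv : v ≠ 0)
    (h : Projectivization.mk ℝ v hv ∈ Ω) :
    ∃ h', Projectivization.mk ℝ ((γ : Matrix (Fin 3) (Fin 3) ℝ).mulVec v) h' ∈ Ω := by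
  have h1 : γ • Ω = Ω := hγ
  have h2 : γ • Projectivization.mk ℝ v hv ∈ γ • Ω := Set.smul_mem_smul_set h
  rw [h1, Projectivization.smul_mk] at h2
  exact ⟨_, h2⟩

/-- An automorphism maps the cone over `Ω` to itself or to its opposite, so that its square
preserves the cone. -/
theorem mulVec_mulVec_mem_coneOver {γ : SL(3, ℝ)} (hC : IsProperCone b (coneOver b Ω))
    (hb : closure Ω ⊆ Set.range (affineChart b)) (hγ : γ ∈ Aut Ω) {v : Fin 3 → ℝ}
    (hv : v ∈ coneOver b Ω) :
    (γ : Matrix (Fin 3) (Fin 3) ℝ).mulVec ((γ : Matrix (Fin 3) (Fin 3) ℝ).mulVec v) ∈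
      coneOver b Ω := by
  let T : (Fin 3 → ℝ) →ₗ[ℝ] (Fin 3 → ℝ) := (γ : Matrix (Fin 3) (Fin 3) ℝ).mulVecLin
  have hT : ∀ w ∈ coneOver b Ω, ∃ h, Projectivization.mk ℝ (T w) h ∈ Ω :=
    fun w hw => mk_mulVec_mem hγ hw.2.1 hw.2.2
  obtain ⟨s, hs, hsT⟩ := hC.exists_sign (l := b.coord 2 ∘ₗ T) fun w hw => by
    obtain ⟨h, hw'⟩ := hT w hw
    exact coord_two_ne_zero hb h (subset_closure hw')
  simp only [LinearMap.comp_apply] at hsT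
  change T (T v) ∈ coneOver b Ω
  rcases hs.lt_or_gt with hs | hs
  · have hneg : ∀ w ∈ coneOver b Ω, -T w ∈ coneOver b Ω := by
      intro w hw
      obtain ⟨h, hw'⟩ := hT w hw
      refine (mem_coneOver_or_neg_mem hb h hw').resolve_left fun h1 => ?_
      have := hsT w hw
      exact absurd (mul_neg_of_neg_of_pos hs h1.1) (not_lt.2 this.le)
    have := hneg _ (hneg v hv)
    rwa [map_neg, neg_neg] at this
  · have hpos : ∀ w ∈ coneOver b Ω, T w ∈ coneOver b Ω := by
      intro w hw
      obtain ⟨h, hw'⟩ := hT w hw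
      exact ⟨pos_of_mul_pos_right (hsT w hw) hs.le, h, hw'⟩
    exact hpos _ (hpos v hv)

end

section

variable {b : Module.Basis (Fin 3) ℝ (Fin 3 → ℝ)} {C : Set (Fin 3 → ℝ)}

/-! ### Finite volume of a peak at the vertex of a conic -/

/-- Near the vertex, a box with sides of order `h` and `h ^ 2` around a point at height of order
`h ^ 2` over the vertex stays inside the conic. -/
theorem conic_estimate {m M A B K h w₀ w₁ w₂ z₀ z₁ z₂ : ℝ} (hm : 0 < m) (hm1 : m ≤ 1) (hM : 0 < M)
    (hh : 0 < h) (hh1 : h ≤ 1) (hs : (1 + M) * h + (|A| + |B|) * h ≤ 1 / 2)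
    (hQ : (M + 1) ^ 2 * (2 + |K|) * h ≤ m / 32)
    (hw2 : m * h ^ 2 / 4 ≤ w₂) (hw2' : w₂ ≤ M * h ^ 2) (hw1 : |w₁| ≤ M * h ^ 2)
    (hw0 : 1 - (1 + M) * h ^ 2 ≤ w₀) (hz : z₀ + A * z₁ + B * z₂ = 0)
    (hz1 : |z₁| < m / 16 * h) (hz2 : |z₂| < m / 16 * h ^ 2) :
    0 < w₂ + z₂ ∧ ((w₁ + z₁) ^ 2 - (w₁ + z₁) * (w₂ + z₂)) / 2 + K * (w₂ + z₂) ^ 2 <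
      (w₀ + z₀) * (w₂ + z₂) := by
  obtain ⟨hz2a, hz2b⟩ := abs_lt.1 hz2
  have hh2 : 0 < h ^ 2 := by positivity
  have hmh : 0 < m * h ^ 2 := by positivity
  have hh21 : h ^ 2 ≤ h := by
    rw [sq]; exact mul_le_of_le_one_left hh.le hh1
  have hmh1 : m * h ≤ h := mul_le_of_le_one_left hh.le hm1
  have hmh2 : m * h ^ 2 ≤ h ^ 2 := mul_le_of_le_one_left hh2.le hm1
  have hMh1 : M * h ^ 2 ≤ M * h := by gcongr
  have hy2 : 3 / 16 * (m * h ^ 2) ≤ w₂ + z₂ := by linarith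
  have hy2' : w₂ + z₂ ≤ (M + 1) * h ^ 2 := by linarith
  have hy2p : 0 < w₂ + z₂ := by linarith
  have hz0 : -((|A| + |B|) * h) ≤ z₀ := by
    have e1 : |A * z₁| ≤ |A| * h := by
      rw [abs_mul]; gcongr; linarith
    have e2 : |B * z₂| ≤ |B| * h := by
      rw [abs_mul]; gcongr; linarith
    linarith [(abs_le.1 e1).2, (abs_le.1 e2).2]
  have hy0 : 1 / 2 ≤ w₀ + z₀ := by
    have : (1 + M) * h ^ 2 ≤ (1 + M) * h := by gcongr
    linarith
  have hy1 : |w₁ + z₁| ≤ M * h ^ 2 + m / 16 * h := (abs_add_le _ _).trans (by linarith)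
  have hy1' : |w₁ + z₁| ≤ (M + 1) * h := by
    refine hy1.trans ?_
    linarith
  have hsq : (w₁ + z₁) ^ 2 ≤ (M * h ^ 2 + m / 16 * h) ^ 2 := by
    rw [← sq_abs]; gcongr
  have hprod : |(w₁ + z₁) * (w₂ + z₂)| ≤ (M + 1) * h * ((M + 1) * h ^ 2) := by
    rw [abs_mul, abs_of_pos hy2p]; gcongr
  have hK : K * (w₂ + z₂) ^ 2 ≤ |K| * ((M + 1) * h ^ 2) ^ 2 := by
    gcongr; exact le_abs_self K
  have hlow : 1 / 2 * (3 / 16 * (m * h ^ 2)) ≤ (w₀ + z₀) * (w₂ + z₂) := by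
    gcongr
  refine ⟨hy2p, lt_of_lt_of_le ?_ hlow⟩
  have hp := (abs_le.1 hprod).1
  have hQ' : (M + 1) ^ 2 * (2 + |K|) * h * h ^ 2 ≤ m / 32 * h ^ 2 := by gcongr
  have hm2 : m * (m * h ^ 2) ≤ 1 * (m * h ^ 2) := by gcongr
  have h3 : 0 < h ^ 3 := by positivity
  have h43 : h ^ 4 ≤ h ^ 3 := pow_le_pow_of_le_one hh.le hh1 (by norm_num)
  have hM4 : M ^ 2 * h ^ 4 ≤ M ^ 2 * h ^ 3 := by gcongr
  have hMm : M * m * h ^ 3 ≤ M * 1 * h ^ 3 := by gcongr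
  have hMh : 0 < M * h ^ 3 := by positivity
  have hMh2 : 0 < M ^ 2 * h ^ 3 := by positivity
  have hK4 : |K| * (M + 1) ^ 2 * h ^ 4 ≤ |K| * (M + 1) ^ 2 * h ^ 3 := by gcongr
  linarith

/-- A peak has finite volume if the cone contains the cone over the interior of a conic through its
vertex: the Finsler unit ball at distance of order `4 ^ (-n)` from the vertex contains a box with
sides of order `2 ^ (-n)` and `4 ^ (-n)`. -/
theorem peakVolume_lt_top_of_conic {u : Module.Basis (Fin 3) ℝ (Fin 3 → ℝ)}
    (hC : IsProperCone b C) (hu : ∀ i, b.coord 2 (u i) = 1)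
    (hu1 : u 1 ∈ C) (hu2 : u 2 ∈ C) (hu0 : u 0 ∈ closure C)
    {l₀ l₁ l₂ : (Fin 3 → ℝ) →ₗ[ℝ] ℝ}
    (h00 : l₀ (u 0) = 1) (h10 : l₁ (u 0) = 0) (h20 : l₂ (u 0) = 0)
    (hinj : ∀ v, l₀ v = 0 → l₁ v = 0 → l₂ v = 0 → v = 0) {A B : ℝ}
    (hAB : ∀ v, b.coord 2 v = l₀ v + A * l₁ v + B * l₂ v)
    (hpos : ∀ v ∈ C, 0 < l₂ v) {K : ℝ}
    (hconic : ∀ v, 0 < l₂ v →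
      (l₁ v ^ 2 - l₁ v * l₂ v) / 2 + K * l₂ v ^ 2 < l₀ v * l₂ v → v ∈ C) :
    peakVolume b u C < ⊤ := by
  obtain ⟨p, hp⟩ := exists_affineVec_eq (hu 0)
  rw [peakVolume, peakSet_eq_cornerTriangle hu hp]
  have hl1 := hpos _ hu1
  have hl2 := hpos _ hu2
  set m : ℝ := min 1 (min (l₂ (u 1)) (l₂ (u 2))) with hmdef
  have hm : 0 < m := by positivity
  have hm1 : m ≤ 1 := min_le_left _ _
  have hmu1 : m ≤ l₂ (u 1) := (min_le_right _ _).trans (min_le_left _ _)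
  have hmu2 : m ≤ l₂ (u 2) := (min_le_right _ _).trans (min_le_right _ _)
  let M : ℝ := 1 + l₂ (u 1) + l₂ (u 2) + |l₁ (u 1)| + |l₁ (u 2)| + |l₀ (u 1)| + |l₀ (u 2)|
  have hM : 0 < M := by positivity
  obtain ⟨κ, hκ, hvol⟩ := exists_normVol_parallelogram (l₁ ∘ₗ affineLin b) (l₂ ∘ₗ affineLin b) (by
    intro v h1 h2
    have h0 := hAB (affineLin b v)
    rw [coord_two_affineLin] at h0
    rw [LinearMap.comp_apply] at h1 h2
    rw [h1, h2, mul_zero, mul_zero, add_zero, add_zero] at h0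
    refine affineLin_injective (b := b) ?_
    rw [map_zero]
    exact hinj _ h0.symm h1 h2)
  -- from the index `n₀` on, the conic gives a box in the unit ball
  obtain ⟨n₀, hn₀⟩ : ∃ n₀ : ℕ, (1 / 2 : ℝ) ^ n₀ *
      ((1 + M) + (|A| + |B|) + (M + 1) ^ 2 * (2 + |K|)) ≤ m / 32 := by
    obtain ⟨n, hn⟩ := exists_pow_lt_of_lt_one
      (show 0 < m / 32 / ((1 + M) + (|A| + |B|) + (M + 1) ^ 2 * (2 + |K|)) by positivity)
      (show (1 / 2 : ℝ) < 1 by norm_num)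
    refine ⟨n, ?_⟩
    rw [lt_div_iff₀ (by positivity)] at hn
    exact hn.le
  -- for smaller indices, balls around the two other vertices give balls in the unit ball
  obtain ⟨δ, hδ, hδ1, hδ2⟩ : ∃ δ : ℝ, 0 < δ ∧ (∀ y : E2, ‖y‖ < δ → u 1 + affineLin b y ∈ C) ∧
      ∀ y : E2, ‖y‖ < δ → u 2 + affineLin b y ∈ C := by
    have hcont := (affineLin b).continuous_of_finiteDimensional
    have key : ∀ w ∈ C, ∃ δ : ℝ, 0 < δ ∧ ∀ y : E2, ‖y‖ < δ → w + affineLin b y ∈ C := by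
      intro w hw
      obtain ⟨δ, hδ, hball⟩ := Metric.mem_nhds_iff.1
        ((hC.isOpen.preimage (continuous_const.add hcont)).mem_nhds
          (show (0 : E2) ∈ (fun y => w + affineLin b y) ⁻¹' C by simpa using hw))
      exact ⟨δ, hδ, fun y hy => hball (by simpa using hy)⟩
    obtain ⟨δ₁, h1, h1'⟩ := key _ hu1
    obtain ⟨δ₂, h2, h2'⟩ := key _ hu2
    exact ⟨min δ₁ δ₂, lt_min h1 h2, fun y hy => h1' y (hy.trans_le (min_le_left _ _)),
      fun y hy => h2' y (hy.trans_le (min_le_right _ _))⟩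
  set r : ℝ := (1 / 4) ^ (n₀ + 1) * δ / 2 with hrdef
  have hr : 0 < r := by positivity
  set V : ℝ := (normVol (Metric.ball (0 : E2) r)).toReal with hVdef
  have hV : 0 < V :=
    ENNReal.toReal_pos (Metric.measure_ball_pos normVol _ hr).ne' measure_ball_lt_top.ne
  have hV' : ENNReal.ofReal V = normVol (Metric.ball (0 : E2) r) :=
    ENNReal.ofReal_toReal measure_ball_lt_top.ne
  refine setLIntegral_cornerTriangle_lt_top (coord_comp_affineLin_injective hu)
    (c := min V (κ * (m / 32) ^ 2)) (by positivity) ?_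
  intro n x hx
  obtain ⟨⟨hs0, ht0, hst1⟩, hstn', hstn⟩ := hx
  set s := (u.coord 1 ∘ₗ affineLin b) (x - p) with hs
  set t := (u.coord 2 ∘ₗ affineLin b) (x - p) with ht
  have hw := affineVec_eq_combination x hu hp hs ht
  have h8 : (0 : ℝ) < (1 / 8) ^ n := by positivity
  have h81 : (1 / 8 : ℝ) ^ n ≤ 1 := pow_le_one₀ (by norm_num) (by norm_num)
  rcases lt_or_ge n n₀ with hn | hn
  · have hball : Metric.ball (0 : E2) r ⊆ finslerBall (affineVec b ⁻¹' C) x := by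
      intro v hv
      rw [mem_ball_zero_iff] at hv
      have hτ : (1 / 4 : ℝ) ^ (n₀ + 1) ≤ s + t :=
        (pow_le_pow_of_le_one (by norm_num) (by norm_num) (by omega)).trans hstn'.le
      have hmem : ∀ y : E2, ‖y‖ < (s + t) * δ → x + y ∈ affineVec b ⁻¹' C := by
        intro y hy
        have hst : 0 < s + t := add_pos hs0 ht0
        have hy' : ‖(s + t)⁻¹ • y‖ < δ := by
          rw [norm_smul, norm_inv, Real.norm_of_nonneg hst.le, inv_mul_lt_iff₀ hst]
          exact hy
        have h1 := hC.smul_mem hs0 (hδ1 _ hy')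
        have h2 := hC.smul_mem ht0 (hδ2 _ hy')
        have h3 := hC.add_mem_of_mem_closure (hC.add_mem h1 h2)
          (hC.smul_mem_closure (show 0 < 1 - (s + t) by linarith) hu0)
        rw [Set.mem_preimage, affineVec_add, hw]
        convert h3 using 1
        have e : affineLin b y = (s + t) • affineLin b ((s + t)⁻¹ • y) := by
          rw [map_smul, smul_smul, mul_inv_cancel₀ hst.ne', one_smul]
        rw [e]
        module
      have hv2 : ‖(2 : ℝ) • v‖ < (s + t) * δ := by
        rw [norm_smul, Real.norm_ofNat]
        have : (1 / 4 : ℝ) ^ (n₀ + 1) * δ ≤ (s + t) * δ := by gcongr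
        linarith
      refine mem_finslerBall hC.isBounded_preimage hC.isOpen_preimage (hmem _ hv2) ?_
      rw [sub_eq_add_neg]
      exact hmem _ (by rwa [norm_neg])
    calc ENNReal.ofReal (min V (κ * (m / 32) ^ 2) * (1 / 8) ^ n)
        ≤ ENNReal.ofReal V := by
          refine ENNReal.ofReal_le_ofReal ?_
          calc min V (κ * (m / 32) ^ 2) * (1 / 8) ^ n ≤ V * 1 := by
                gcongr; exact min_le_left _ _
            _ = V := mul_one V
      _ ≤ _ := by rw [hV']; exact measure_mono hball
  · set h : ℝ := (1 / 2) ^ n with hhdef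
    have hh : 0 < h := by positivity
    have hh1 : h ≤ 1 := pow_le_one₀ (by norm_num) (by norm_num)
    have h4 : (1 / 4 : ℝ) ^ n = h ^ 2 := by
      rw [hhdef, ← pow_mul, mul_comm n 2, pow_mul]; norm_num
    have hh8 : (1 / 8 : ℝ) ^ n = h ^ 3 := by
      rw [hhdef, ← pow_mul, mul_comm n 3, pow_mul]; norm_num
    have hhn : h * ((1 + M) + (|A| + |B|) + (M + 1) ^ 2 * (2 + |K|)) ≤ m / 32 := by
      refine le_trans ?_ hn₀
      gcongr
      exact pow_le_pow_of_le_one (by norm_num) (by norm_num) hn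
    rw [pow_succ, h4] at hstn'
    rw [h4] at hstn
    have hb0 := abs_nonneg A
    have hb1 := abs_nonneg B
    have hb2 := abs_nonneg K
    have hsmall : (1 + M) * h + (|A| + |B|) * h ≤ 1 / 2 := by
      have : 0 ≤ (M + 1) ^ 2 * (2 + |K|) * h := by positivity
      linarith
    have hQ : (M + 1) ^ 2 * (2 + |K|) * h ≤ m / 32 := by
      have : 0 ≤ (1 + M) * h + (|A| + |B|) * h := by positivity
      linarith
    clear_value h
    have bound : ∀ l : (Fin 3 → ℝ) →ₗ[ℝ] ℝ, |l (u 1)| ≤ M → |l (u 2)| ≤ M →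
        |s * l (u 1) + t * l (u 2)| ≤ M * h ^ 2 := by
      intro l h1 h2
      calc |s * l (u 1) + t * l (u 2)| ≤ |s * l (u 1)| + |t * l (u 2)| := abs_add_le _ _
        _ = s * |l (u 1)| + t * |l (u 2)| := by
            rw [abs_mul, abs_mul, abs_of_pos hs0, abs_of_pos ht0]
        _ ≤ s * M + t * M := by gcongr
        _ = M * (s + t) := by ring
        _ ≤ M * h ^ 2 := by gcongr
    have a1 := abs_nonneg (l₁ (u 1))
    have a2 := abs_nonneg (l₁ (u 2))
    have a3 := abs_nonneg (l₀ (u 1))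
    have a4 := abs_nonneg (l₀ (u 2))
    have e2 : l₂ (affineVec b x) = s * l₂ (u 1) + t * l₂ (u 2) := by
      rw [hw]; simp [h20]
    have e1 : l₁ (affineVec b x) = s * l₁ (u 1) + t * l₁ (u 2) := by
      rw [hw]; simp [h10]
    have e0 : l₀ (affineVec b x) = (1 - (s + t)) + (s * l₀ (u 1) + t * l₀ (u 2)) := by
      rw [hw]; simp [h00, add_assoc]
    have c2 := bound l₂ (by rw [abs_of_pos hl1]; simp only [M]; linarith)
      (by rw [abs_of_pos hl2]; simp only [M]; linarith)
    have c1 := bound l₁ (by simp only [M]; linarith) (by simp only [M]; linarith)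
    have c0 := bound l₀ (by simp only [M]; linarith) (by simp only [M]; linarith)
    have hmem : ∀ v : E2, |l₁ (affineLin b v)| < m / 16 * h →
        |l₂ (affineLin b v)| < m / 16 * h ^ 2 →
        x + v ∈ affineVec b ⁻¹' C := by
      intro v h1 h2
      have hz := hAB (affineLin b v)
      rw [coord_two_affineLin] at hz
      obtain ⟨g1, g2⟩ := conic_estimate (A := A) (B := B) (K := K) hm hm1 hM hh hh1 hsmall hQ
        (w₀ := l₀ (affineVec b x)) (w₁ := l₁ (affineVec b x)) (w₂ := l₂ (affineVec b x))
        (by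
          rw [e2]
          have : s * m + t * m ≤ s * l₂ (u 1) + t * l₂ (u 2) := by gcongr
          have h14 : m * (h ^ 2 * (1 / 4)) ≤ m * (s + t) := by gcongr
          linarith)
        (by rw [e2]; exact (abs_le.1 c2).2) (by rw [e1]; exact c1)
        (by rw [e0]; linarith [(abs_le.1 c0).1]) hz.symm h1 h2
      rw [Set.mem_preimage, affineVec_add]
      refine hconic _ ?_ ?_
      · rw [map_add]; exact g1
      · rw [map_add, map_add, map_add]; exact g2
    have hbox : parallelogram (l₁ ∘ₗ affineLin b) (l₂ ∘ₗ affineLin b)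
        (m / 32 * h) (m / 32 * h ^ 2) ⊆ finslerBall (affineVec b ⁻¹' C) x := by
      rintro v ⟨hv1, hv2⟩
      rw [LinearMap.comp_apply] at hv1 hv2
      have k1 : |l₁ (affineLin b ((2 : ℝ) • v))| < m / 16 * h := by
        rw [map_smul, map_smul, smul_eq_mul, abs_mul, abs_two]; linarith
      have k2 : |l₂ (affineLin b ((2 : ℝ) • v))| < m / 16 * h ^ 2 := by
        rw [map_smul, map_smul, smul_eq_mul, abs_mul, abs_two]; linarith
      refine mem_finslerBall hC.isBounded_preimage hC.isOpen_preimage (hmem _ k1 k2) ?_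
      rw [sub_eq_add_neg]
      exact hmem _ (by rwa [map_neg, map_neg, abs_neg]) (by rwa [map_neg, map_neg, abs_neg])
    calc ENNReal.ofReal (min V (κ * (m / 32) ^ 2) * (1 / 8) ^ n)
        ≤ ENNReal.ofReal (κ * (m / 32 * h * (m / 32 * h ^ 2))) := by
          refine ENNReal.ofReal_le_ofReal ?_
          calc min V (κ * (m / 32) ^ 2) * (1 / 8) ^ n ≤ κ * (m / 32) ^ 2 * (1 / 8) ^ n := by
                gcongr; exact min_le_right _ _
            _ = _ := by rw [hh8]; ring
      _ = normVol (parallelogram (l₁ ∘ₗ affineLin b) (l₂ ∘ₗ affineLin b)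
            (m / 32 * h) (m / 32 * h ^ 2)) := (hvol _ _ (by positivity) (by positivity)).symm
      _ ≤ _ := measure_mono hbox

/-- A cone stable under the integral powers of the square of a parabolic map contains the cone over
the interior of a conic: in the affine chart `l₂ = 1` it is stable under translation by positive
multiples of `u₀`, and it contains a chord over each interval of a periodic subdivision of the
`l₁`-axis, at bounded height over a parabola. -/
theorem exists_conic_subset (hC : IsProperCone b C) {u₀ : Fin 3 → ℝ} (hu0 : u₀ ∈ closure C)
    {l₀ l₁ l₂ : (Fin 3 → ℝ) →ₗ[ℝ] ℝ}
    (h00 : l₀ u₀ = 1) (h10 : l₁ u₀ = 0) (h20 : l₂ u₀ = 0)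
    (hinj : ∀ v, l₀ v = 0 → l₁ v = 0 → l₂ v = 0 → v = 0)
    (hpos : ∀ v ∈ C, 0 < l₂ v)
    (horbit : ∀ (n : ℤ), ∀ v ∈ C, ∃ w ∈ C, l₀ w = l₀ v + 2 * n * l₁ v + (2 * n ^ 2 - n) * l₂ v ∧
      l₁ w = l₁ v + 2 * n * l₂ v ∧ l₂ w = l₂ v) :
    ∃ K : ℝ, ∀ v, 0 < l₂ v →
      (l₁ v ^ 2 - l₁ v * l₂ v) / 2 + K * l₂ v ^ 2 < l₀ v * l₂ v → v ∈ C := by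
  obtain ⟨v₀, hv₀⟩ : C.Nonempty := closure_nonempty_iff.1 ⟨u₀, hu0⟩
  have hv₀' := hpos _ hv₀
  obtain ⟨a, ha, ha2⟩ : ∃ a ∈ C, l₂ a = 1 :=
    ⟨_, hC.smul_mem (inv_pos.2 hv₀') hv₀, by
      rw [map_smul, smul_eq_mul, inv_mul_cancel₀ hv₀'.ne']⟩
  set t := l₁ a with ht
  refine ⟨l₀ a - t ^ 2 / 2 + t / 2 + 1 / 2, ?_⟩
  -- it suffices to treat the points of the chart `l₂ = 1`
  have key : ∀ x, l₂ x = 1 → (l₁ x ^ 2 - l₁ x) / 2 + (l₀ a - t ^ 2 / 2 + t / 2 + 1 / 2) < l₀ x →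
      x ∈ C := by
    intro x hx2 hx
    set n : ℤ := ⌊(l₁ x - t) / 2⌋ with hn
    set θ : ℝ := (l₁ x - t) / 2 - n with hθ
    have hθ0 : 0 ≤ θ := sub_nonneg.2 (Int.floor_le _)
    have hθ1 : θ ≤ 1 := by
      have := Int.lt_floor_add_one ((l₁ x - t) / 2)
      rw [← hn] at this
      linarith
    have hx1 : l₁ x = t + 2 * n + 2 * θ := by rw [hθ]; ring
    obtain ⟨w, hw, hw0, hw1, hw2⟩ := horbit n a ha
    obtain ⟨w', hw', hw0', hw1', hw2'⟩ := horbit (n + 1) a ha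
    have hy : (1 - θ) • w + θ • w' ∈ C :=
      hC.convex hw hw' (sub_nonneg.2 hθ1) hθ0 (by ring)
    set y := (1 - θ) • w + θ • w' with hydef
    rw [ha2] at hw0 hw1 hw2 hw0' hw1' hw2'
    rw [← ht] at hw0 hw1 hw0' hw1'
    push_cast at hw0' hw1'
    have hy0 : l₀ y = l₀ a + 2 * n * t + 2 * n ^ 2 - n + θ * (2 * t + 4 * n + 1) := by
      rw [hydef, map_add, map_smul, map_smul, hw0, hw0', smul_eq_mul, smul_eq_mul]; ring
    have hy1 : l₁ y = l₁ x := by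
      rw [hydef, map_add, map_smul, map_smul, hw1, hw1', smul_eq_mul, smul_eq_mul, hx1]; ring
    have hy2 : l₂ y = 1 := by
      rw [hydef, map_add, map_smul, map_smul, hw2, hw2', smul_eq_mul, smul_eq_mul]; ring
    have hlt : l₀ y < l₀ x := by
      refine lt_of_le_of_lt ?_ hx
      rw [hy0, hx1]
      nlinarith [sq_nonneg (θ - 1 / 2)]
    have hxy : x = y + (l₀ x - l₀ y) • u₀ := by
      rw [← sub_eq_zero]
      refine hinj _ ?_ ?_ ?_
      · simp [h00]
      · simp [h10, hy1]
      · simp [h20, hy2, hx2]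
    rw [hxy]
    exact hC.add_mem_of_mem_closure hy (hC.smul_mem_closure (sub_pos.2 hlt) hu0)
  intro v hv2 hv
  have hmem : (l₂ v)⁻¹ • v ∈ C := by
    refine key _ (by rw [map_smul, smul_eq_mul, inv_mul_cancel₀ hv2.ne']) ?_
    rw [map_smul, map_smul, smul_eq_mul, smul_eq_mul]
    have h1 : (((l₂ v)⁻¹ * l₁ v) ^ 2 - (l₂ v)⁻¹ * l₁ v) / 2 +
        (l₀ a - t ^ 2 / 2 + t / 2 + 1 / 2) = ((l₁ v ^ 2 - l₁ v * l₂ v) / 2 +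
        (l₀ a - t ^ 2 / 2 + t / 2 + 1 / 2) * l₂ v ^ 2) * ((l₂ v)⁻¹ * (l₂ v)⁻¹) := by
      field_simp
    have h2 : (l₂ v)⁻¹ * l₀ v = l₀ v * l₂ v * ((l₂ v)⁻¹ * (l₂ v)⁻¹) := by
      field_simp
    rw [h1, h2]
    have := inv_pos.2 hv2
    gcongr
  have := hC.smul_mem hv2 hmem
  rwa [smul_smul, mul_inv_cancel₀ hv2.ne', one_smul] at this

end

section

variable {b e : Module.Basis (Fin 3) ℝ (Fin 3 → ℝ)} {C : Set (Fin 3 → ℝ)}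
  {N N' : (Fin 3 → ℝ) → Fin 3 → ℝ}

/-! ### Orbits of linear maps in eigencoordinates -/

open Filter Topology

theorem tendsto_of_coord (e : Module.Basis (Fin 3) ℝ (Fin 3 → ℝ)) {z : ℕ → Fin 3 → ℝ}
    {w : Fin 3 → ℝ} (h : ∀ i, Tendsto (fun n => e.coord i (z n)) atTop (𝓝 (e.coord i w))) :
    Tendsto z atTop (𝓝 w) := by
  have h1 : z = fun n => ∑ i, e.coord i (z n) • e i := by
    funext n
    exact (e.sum_repr (z n)).symm
  have h2 : w = ∑ i, e.coord i w • e i := (e.sum_repr w).symm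
  rw [h1, h2]
  exact tendsto_finsetSum _ fun i _ => (h i).smul_const _

theorem coord_self (i j : Fin 3) : e.coord i (e j) = if j = i then 1 else 0 := by
  rw [Module.Basis.coord_apply, Module.Basis.repr_self, Finsupp.single_apply]

theorem coord_ne_zero (i : Fin 3) : e.coord i ≠ 0 := by
  intro h
  have := LinearMap.congr_fun h (e i)
  rw [coord_self, if_pos rfl] at this
  exact one_ne_zero this

theorem coord_two_eq_sum (v : Fin 3 → ℝ) :
    b.coord 2 v = b.coord 2 (e 0) * e.coord 0 v + b.coord 2 (e 1) * e.coord 1 v +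
      b.coord 2 (e 2) * e.coord 2 v := by
  conv_lhs => rw [← e.sum_repr v]
  rw [map_sum, Fin.sum_univ_three]
  simp only [map_smul, smul_eq_mul, Module.Basis.coord_apply]
  ring

theorem iterate_mem (hN : ∀ v ∈ C, N v ∈ C) (n : ℕ) : ∀ v ∈ C, N^[n] v ∈ C := by
  induction n with
  | zero => exact fun v hv => hv
  | succ n ih =>
    intro v hv
    rw [Function.iterate_succ_apply']
    exact hN _ (ih v hv)

/-- A functional dual to a simple dominating eigenvalue has constant sign on a stable cone. -/
theorem pos_of_dominating (hC : IsProperCone b C) {d : Fin 3 → ℝ} (hd : ∀ i, 0 < d i)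
    (hNC : ∀ v ∈ C, N v ∈ C) (hN : ∀ v i, e.coord i (N v) = d i * e.coord i v) {i : Fin 3}
    (hi : ∀ j, j ≠ i → d j < d i) : ∀ v ∈ C, 0 < b.coord 2 (e i) * e.coord i v := by
  intro v hv
  have hiter : ∀ (n : ℕ) v j, e.coord j (N^[n] v) = d j ^ n * e.coord j v := by
    intro n
    induction n with
    | zero => simp
    | succ n ih =>
      intro v j
      rw [Function.iterate_succ_apply', hN, ih, pow_succ]; ring
  refine hC.mul_pos_of_tendsto (coord_ne_zero i) (e.ne_zero i) (Z := fun n => N^[n])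
    (r := fun n => (d i ^ n)⁻¹) (iterate_mem hNC)
    (Eventually.of_forall fun n => inv_pos.2 (pow_pos (hd i) n)) (fun w => ?_) hv
  refine tendsto_of_coord e fun j => ?_
  simp only [map_smul, smul_eq_mul, hiter, coord_self]
  by_cases hj : i = j
  · subst hj
    rw [if_pos rfl, mul_one]
    refine tendsto_const_nhds.congr fun n => ?_
    rw [inv_mul_cancel_left₀ (pow_pos (hd i) n).ne']
  · rw [if_neg hj, mul_zero]
    have := (tendsto_pow_atTop_nhds_zero_of_lt_one (div_nonneg (hd j).le (hd i).le)
      ((div_lt_one (hd i)).2 (hi j (Ne.symm hj)))).mul_const (e.coord j w)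
    rw [zero_mul] at this
    refine this.congr fun n => ?_
    rw [div_pow]
    field_simp

/-- In the coordinates of `e`, the map `N` has the matrix `!![α, c, 0; 0, α, 0; 0, 0, β]`. -/
structure IsJordanMap (e : Module.Basis (Fin 3) ℝ (Fin 3 → ℝ)) (N : (Fin 3 → ℝ) → Fin 3 → ℝ)
    (α c β : ℝ) : Prop where
  zero : ∀ v, e.coord 0 (N v) = α * e.coord 0 v + c * e.coord 1 v
  one : ∀ v, e.coord 1 (N v) = α * e.coord 1 v
  two : ∀ v, e.coord 2 (N v) = β * e.coord 2 v

namespace IsJordanMap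

variable {α c β : ℝ}

theorem iterate (hN : IsJordanMap e N α c β) (hα : α ≠ 0) (n : ℕ) (v : Fin 3 → ℝ) :
    e.coord 0 (N^[n] v) = α ^ n * (e.coord 0 v + n * (c / α) * e.coord 1 v) ∧
      e.coord 1 (N^[n] v) = α ^ n * e.coord 1 v ∧ e.coord 2 (N^[n] v) = β ^ n * e.coord 2 v := by
  induction n with
  | zero => simp
  | succ n ih =>
    obtain ⟨h0, h1, h2⟩ := ih
    rw [Function.iterate_succ_apply', hN.zero, hN.one, hN.two, h0, h1, h2]
    refine ⟨?_, by ring, by ring⟩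
    push_cast
    field_simp
    ring

/-- If the double eigenvalue dominates, all orbits converge to the point `e 0`. -/
theorem pos_of_lt (hC : IsProperCone b C) (hN : IsJordanMap e N α c β) (hNC : ∀ v ∈ C, N v ∈ C)
    (hβ : 0 < β) (hαβ : β < α) (hc : c ≠ 0) :
    ∀ v ∈ C, 0 < b.coord 2 (e 0) * (c / α * e.coord 1 v) := by
  intro v hv
  have hα : 0 < α := hβ.trans hαβ
  refine hC.mul_pos_of_tendsto (l := (c / α) • e.coord 1)
    (smul_ne_zero (div_ne_zero hc hα.ne') (coord_ne_zero 1)) (e.ne_zero 0) (Z := fun n => N^[n])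
    (r := fun n => ((n : ℝ) * α ^ n)⁻¹) (iterate_mem hNC) ?_ (fun w => ?_) hv
  · filter_upwards [eventually_gt_atTop 0] with n hn
    have : (0 : ℝ) < n := Nat.cast_pos.2 hn
    positivity
  have hinv := tendsto_inv_atTop_nhds_zero_nat (𝕜 := ℝ)
  refine tendsto_of_coord e fun j => ?_
  fin_cases j
  · simp only [Fin.zero_eta, map_smul, smul_eq_mul, coord_self, if_true, mul_one,
      LinearMap.smul_apply]
    have := (hinv.mul_const (e.coord 0 w)).add_const (c / α * e.coord 1 w)
    rw [zero_mul, zero_add] at this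
    refine this.congr' ?_
    filter_upwards [eventually_gt_atTop 0] with n hn
    have : (n : ℝ) ≠ 0 := (Nat.cast_pos.2 hn).ne'
    rw [(hN.iterate hα.ne' n w).1]
    field_simp
  · simp only [Fin.mk_one, map_smul, smul_eq_mul, coord_self]
    rw [if_neg (by decide), mul_zero]
    have := hinv.mul_const (e.coord 1 w)
    rw [zero_mul] at this
    refine this.congr fun n => ?_
    rw [(hN.iterate hα.ne' n w).2.1, mul_inv]
    field_simp
  · simp only [Fin.reduceFinMk, map_smul, smul_eq_mul, coord_self]
    rw [if_neg (by decide), mul_zero]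
    have := (hinv.mul (tendsto_pow_atTop_nhds_zero_of_lt_one (div_nonneg hβ.le hα.le)
      ((div_lt_one hα).2 hαβ))).mul_const (e.coord 2 w)
    rw [zero_mul, zero_mul] at this
    refine this.congr fun n => ?_
    rw [(hN.iterate hα.ne' n w).2.2, mul_inv, div_pow]
    field_simp

/-- If the simple eigenvalue dominates, all orbits converge to the point `e 2`. -/
theorem pos_of_gt (hC : IsProperCone b C) (hN : IsJordanMap e N α c β) (hNC : ∀ v ∈ C, N v ∈ C)
    (hα : 0 < α) (hαβ : α < β) : ∀ v ∈ C, 0 < b.coord 2 (e 2) * e.coord 2 v := by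
  intro v hv
  have hβ : 0 < β := hα.trans hαβ
  refine hC.mul_pos_of_tendsto (coord_ne_zero 2) (e.ne_zero 2) (Z := fun n => N^[n])
    (r := fun n => (β ^ n)⁻¹) (iterate_mem hNC)
    (Eventually.of_forall fun n => by positivity) (fun w => ?_) hv
  have hρ0 : 0 ≤ α / β := div_nonneg hα.le hβ.le
  have hρ1 : α / β < 1 := (div_lt_one hβ).2 hαβ
  have hpow := tendsto_pow_atTop_nhds_zero_of_lt_one hρ0 hρ1
  have hnpow := tendsto_self_mul_const_pow_of_lt_one hρ0 hρ1
  refine tendsto_of_coord e fun j => ?_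
  fin_cases j
  · simp only [Fin.zero_eta, map_smul, smul_eq_mul, coord_self]
    rw [if_neg (by decide), mul_zero]
    have := (hpow.mul_const (e.coord 0 w)).add (hnpow.mul_const (c / α * e.coord 1 w))
    rw [zero_mul, zero_mul, add_zero] at this
    refine this.congr fun n => ?_
    rw [(hN.iterate hα.ne' n w).1, div_pow]
    field_simp
  · simp only [Fin.mk_one, map_smul, smul_eq_mul, coord_self]
    rw [if_neg (by decide), mul_zero]
    have := hpow.mul_const (e.coord 1 w)
    rw [zero_mul] at this
    refine this.congr fun n => ?_
    rw [(hN.iterate hα.ne' n w).2.1, div_pow]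
    field_simp
  · simp only [Fin.reduceFinMk, map_smul, smul_eq_mul, coord_self, if_true, mul_one]
    refine tendsto_const_nhds.congr fun n => ?_
    rw [(hN.iterate hα.ne' n w).2.2]
    field_simp

end IsJordanMap

/-! ### The volume of a peak at a fixed point -/

section Volume

variable {u : Module.Basis (Fin 3) ℝ (Fin 3 → ℝ)}

theorem eq_smul_of_coord {v : Fin 3 → ℝ} (i : Fin 3) (h : ∀ j, j ≠ i → e.coord j v = 0) :
    v = e.coord i v • e i := by
  refine e.ext_elem fun j => ?_
  by_cases hj : j = i
  · subst hj; simp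
  · have h1 := h j hj
    rw [Module.Basis.coord_apply] at h1
    simp [h1, Ne.symm hj]

/-- Two of the three coordinates vanish simultaneously only on one line. -/
theorem exists_eq_smul_of_coord_eq_zero {i j k : Fin 3} (hk : ∀ m, m ≠ k → m = i ∨ m = j)
    {w : Fin 3 → ℝ} (hw : w ≠ 0) (hwi : e.coord i w = 0) (hwj : e.coord j w = 0) {v : Fin 3 → ℝ}
    (hi : e.coord i v = 0) (hj : e.coord j v = 0) : ∃ a : ℝ, v = a • w := by
  have h : ∀ z : Fin 3 → ℝ, e.coord i z = 0 → e.coord j z = 0 → z = e.coord k z • e k := by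
    intro z hzi hzj
    refine eq_smul_of_coord k fun m hm => ?_
    rcases hk m hm with rfl | rfl <;> assumption
  have hwk := h w hwi hwj
  have hne : e.coord k w ≠ 0 := by
    intro h0
    rw [h0, zero_smul] at hwk
    exact hw hwk
  refine ⟨e.coord k v / e.coord k w, ?_⟩
  rw [hwk, smul_smul, map_smul, coord_self, if_pos rfl, smul_eq_mul, mul_one,
    div_mul_cancel₀ _ hne]
  exact h v hi hj

/-- The corner criterion in terms of two eigencoordinates of constant sign. -/
theorem peakVolume_eq_top_of_signs (hC : IsProperCone b C) (hu : ∀ i, b.coord 2 (u i) = 1)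
    (hu1 : u 1 ∈ C) (hu2 : u 2 ∈ C) (hu0 : u 0 ∈ closure C) {i j k : Fin 3}
    (hk : ∀ m, m ≠ k → m = i ∨ m = j) {s t : ℝ} (hi : ∀ v ∈ C, 0 < s * e.coord i v)
    (hj : ∀ v ∈ C, 0 < t * e.coord j v) (h0i : e.coord i (u 0) = 0) (h0j : e.coord j (u 0) = 0) :
    peakVolume b u C = ⊤ := by
  have hs : s ≠ 0 := left_ne_zero_of_mul (hi _ hu1).ne'
  have ht : t ≠ 0 := left_ne_zero_of_mul (hj _ hu1).ne'
  refine peakVolume_eq_top_of_corner hC hu hu1 hu2 hu0 (l₁ := s • e.coord i) (l₂ := t • e.coord j)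
    ?_ ?_ ?_ hi hj
  · rw [LinearMap.smul_apply, h0i, smul_zero]
  · rw [LinearMap.smul_apply, h0j, smul_zero]
  · intro v h1 h2
    exact exists_eq_smul_of_coord_eq_zero hk (u.ne_zero 0) h0i h0j
      ((smul_eq_zero.1 h1).resolve_left hs)
      ((smul_eq_zero.1 h2).resolve_left ht)

/-- Peaks at a fixed point of a quasi-hyperbolic map have infinite volume. At `e 0` the cone has a
corner. At `e 2` it has a tangent line, but applying the positivity of `b.coord 2` to a whole orbit
shows that the cone leaves this tangent only logarithmically faster than a sector. -/
theorem peakVolume_eq_top_of_isJordanMap (hC : IsProperCone b C)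
    (hu : ∀ i, b.coord 2 (u i) = 1) (hu1 : u 1 ∈ C) (hu2 : u 2 ∈ C) (hu0 : u 0 ∈ closure C)
    {α c β α' c' β' : ℝ} (hN : IsJordanMap e N α c β) (hNC : ∀ v ∈ C, N v ∈ C)
    (hN' : IsJordanMap e N' α' c' β') (hNC' : ∀ v ∈ C, N' v ∈ C)
    (hβ : 0 < β) (hαβ : β < α) (hα' : 0 < α') (hαβ' : α' < β') (hc : c ≠ 0)
    (h1 : e.coord 1 (u 0) = 0) (h02 : e.coord 0 (u 0) = 0 ∨ e.coord 2 (u 0) = 0) :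
    peakVolume b u C = ⊤ := by
  have hα : 0 < α := hβ.trans hαβ
  have hp1 := hN.pos_of_lt hC hNC hβ hαβ hc
  simp only [← mul_assoc] at hp1
  rcases h02 with h0 | h2
  · set φ₀ := b.coord 2 (e 0) with hφ₀
    set φ₁ := b.coord 2 (e 1) with hφ₁
    set φ₂ := b.coord 2 (e 2) with hφ₂
    set q := φ₀ * (c / α) with hq
    have hqne : q ≠ 0 := left_ne_zero_of_mul (hp1 _ hu1).ne'
    have hφ₀ne : φ₀ ≠ 0 := left_ne_zero_of_mul hqne
    obtain ⟨m, hm, hmC⟩ := hC.exists_bound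
    -- a bound for the third coordinate on the slice `b.coord 2 = 1`
    obtain ⟨R, hR0, hR⟩ : ∃ R : ℝ, 0 ≤ R ∧ ∀ v ∈ C, |φ₂ * e.coord 2 v| ≤ R * b.coord 2 v := by
      let F : (Fin 3 → ℝ) →L[ℝ] ℝ := LinearMap.toContinuousLinearMap (φ₂ • e.coord 2)
      refine ⟨‖F‖ / m, by positivity, fun v hv => ?_⟩
      calc |φ₂ * e.coord 2 v| = ‖F v‖ := rfl
        _ ≤ ‖F‖ * ‖v‖ := F.le_opNorm v
        _ = ‖F‖ / m * (m * ‖v‖) := by field_simp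
        _ ≤ ‖F‖ / m * b.coord 2 v := by gcongr; exact hmC v hv
    refine peakVolume_eq_top_of_growth hC hu hu1 hu2 hu0 (l₁ := φ₀ • e.coord 0)
      (l₂ := q • e.coord 1) ?_ ?_ ?_ hp1 (ρ := β / α) (K := |φ₁ / q| + R + 1)
      (by positivity) ((div_lt_one hα).2 hαβ) (by positivity) ?_
    · rw [LinearMap.smul_apply, h0, smul_zero]
    · rw [LinearMap.smul_apply, h1, smul_zero]
    · intro v hv1 hv2
      exact exists_eq_smul_of_coord_eq_zero (i := 0) (j := 1) (k := 2) (by decide)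
        (u.ne_zero 0) h0 h1
        ((smul_eq_zero.1 hv1).resolve_left hφ₀ne) ((smul_eq_zero.1 hv2).resolve_left hqne)
    · intro n v hv
      have hpos := hC.pos (iterate_mem hNC n v hv)
      obtain ⟨g0, g1, g2⟩ := hN.iterate hα.ne' n v
      rw [coord_two_eq_sum (e := e), g0, g1, g2] at hpos
      have hy := hp1 v hv
      have hφ := hC.pos hv
      have hRv := hR v hv
      simp only [LinearMap.smul_apply, smul_eq_mul]
      rw [← hφ₀, ← hφ₁, ← hφ₂] at hpos
      have hαn : 0 < α ^ n := pow_pos hα n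
      have e1 : φ₀ * (α ^ n * (e.coord 0 v + n * (c / α) * e.coord 1 v)) +
          φ₁ * (α ^ n * e.coord 1 v) + φ₂ * (β ^ n * e.coord 2 v) =
          α ^ n * (φ₀ * e.coord 0 v + n * (q * e.coord 1 v) + φ₁ / q * (q * e.coord 1 v) +
            (β / α) ^ n * (φ₂ * e.coord 2 v)) := by
        rw [div_pow, hq]
        field_simp
      rw [e1] at hpos
      have hpos' := pos_of_mul_pos_right hpos hαn.le
      set y := q * e.coord 1 v
      set z := φ₂ * e.coord 2 v
      set w := b.coord 2 v
      have hρn : 0 < (β / α) ^ n := by positivity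
      have k1 : φ₁ / q * y ≤ |φ₁ / q| * y := by gcongr; exact le_abs_self _
      have k2 : (β / α) ^ n * z ≤ (β / α) ^ n * (R * w) := by
        gcongr; exact (le_abs_self z).trans hRv
      have hn : (0 : ℝ) ≤ n := Nat.cast_nonneg n
      have t1 : 0 ≤ |φ₁ / q| * (n * y) := by positivity
      have t2 : 0 ≤ R * ((n + 1) * y) := by positivity
      have t3 : 0 ≤ (|φ₁ / q| + 1) * ((β / α) ^ n * w) := by positivity
      linarith
  · exact peakVolume_eq_top_of_signs hC hu hu1 hu2 hu0 (i := 1) (j := 2) (k := 0) (by decide)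
      hp1 (hN'.pos_of_gt hC hNC' hα' hαβ') h1 h2

/-- Peaks at the fixed point of a parabolic map have finite volume. -/
theorem peakVolume_lt_top_of_parabolic (hC : IsProperCone b C)
    (hu : ∀ i, b.coord 2 (u i) = 1) (hu1 : u 1 ∈ C) (hu2 : u 2 ∈ C) (hu0 : u 0 ∈ closure C)
    (hN0 : ∀ v, e.coord 0 (N v) = e.coord 0 v + 2 * e.coord 1 v + e.coord 2 v)
    (hN1 : ∀ v, e.coord 1 (N v) = e.coord 1 v + 2 * e.coord 2 v)
    (hN2 : ∀ v, e.coord 2 (N v) = e.coord 2 v) (hNC : ∀ v ∈ C, N v ∈ C)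
    (hN0' : ∀ v, e.coord 0 (N' v) = e.coord 0 v - 2 * e.coord 1 v + 3 * e.coord 2 v)
    (hN1' : ∀ v, e.coord 1 (N' v) = e.coord 1 v - 2 * e.coord 2 v)
    (hN2' : ∀ v, e.coord 2 (N' v) = e.coord 2 v) (hNC' : ∀ v ∈ C, N' v ∈ C)
    (h1 : e.coord 1 (u 0) = 0) (h2 : e.coord 2 (u 0) = 0) : peakVolume b u C < ⊤ := by
  -- the powers of `N`, which is the square of a unipotent Jordan block
  have hiter : ∀ (n : ℕ) v, e.coord 0 (N^[n] v) = e.coord 0 v + 2 * n * e.coord 1 v +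
      (2 * n ^ 2 - n) * e.coord 2 v ∧ e.coord 1 (N^[n] v) = e.coord 1 v + 2 * n * e.coord 2 v ∧
      e.coord 2 (N^[n] v) = e.coord 2 v := by
    intro n
    induction n with
    | zero => simp
    | succ n ih =>
      intro v
      obtain ⟨g0, g1, g2⟩ := ih v
      rw [Function.iterate_succ_apply', hN0, hN1, hN2, g0, g1, g2]
      push_cast
      exact ⟨by ring, by ring, rfl⟩
  have horbit : ∀ (n : ℤ), ∀ v ∈ C, ∃ w ∈ C, e.coord 0 w = e.coord 0 v + 2 * n * e.coord 1 v +
      (2 * n ^ 2 - n) * e.coord 2 v ∧ e.coord 1 w = e.coord 1 v + 2 * n * e.coord 2 v ∧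
      e.coord 2 w = e.coord 2 v := by
    intro n v hv
    induction n with
    | zero => exact ⟨v, hv, by simp⟩
    | succ n ih =>
      obtain ⟨w, hw, g0, g1, g2⟩ := ih
      refine ⟨N w, hNC w hw, ?_⟩
      rw [hN0, hN1, hN2, g0, g1, g2]
      push_cast
      exact ⟨by ring, by ring, rfl⟩
    | pred n ih =>
      obtain ⟨w, hw, g0, g1, g2⟩ := ih
      refine ⟨N' w, hNC' w hw, ?_⟩
      rw [hN0', hN1', hN2', g0, g1, g2]
      push_cast
      exact ⟨by ring, by ring, rfl⟩
  have hpos : ∀ v ∈ C, 0 < b.coord 2 (e 0) * e.coord 2 v := by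
    intro v hv
    refine hC.mul_pos_of_tendsto (coord_ne_zero 2) (e.ne_zero 0) (Z := fun n => N^[n])
      (r := fun n => (2 * (n : ℝ) ^ 2)⁻¹) (iterate_mem hNC) ?_ (fun w => ?_) hv
    · filter_upwards [eventually_gt_atTop 0] with n hn
      have : (0 : ℝ) < n := Nat.cast_pos.2 hn
      positivity
    have hinv := tendsto_inv_atTop_nhds_zero_nat (𝕜 := ℝ)
    have hinv2 := hinv.mul hinv
    rw [zero_mul] at hinv2
    refine tendsto_of_coord e fun j => ?_
    fin_cases j
    · simp only [Fin.zero_eta, map_smul, smul_eq_mul, coord_self, if_true, mul_one]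
      have := (((hinv2.mul_const (e.coord 0 w / 2)).add (hinv.mul_const (e.coord 1 w))).sub
        (hinv.mul_const (e.coord 2 w / 2))).add_const (e.coord 2 w)
      rw [zero_mul, zero_mul, zero_mul, add_zero, sub_zero, zero_add] at this
      refine this.congr' ?_
      filter_upwards [eventually_gt_atTop 0] with n hn
      have : (n : ℝ) ≠ 0 := (Nat.cast_pos.2 hn).ne'
      rw [(hiter n w).1]
      field_simp
      ring
    · simp only [Fin.mk_one, map_smul, smul_eq_mul, coord_self]
      rw [if_neg (by decide), mul_zero]
      have := (hinv2.mul_const (e.coord 1 w / 2)).add (hinv.mul_const (e.coord 2 w))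
      rw [zero_mul, zero_mul, add_zero] at this
      refine this.congr' ?_
      filter_upwards [eventually_gt_atTop 0] with n hn
      have : (n : ℝ) ≠ 0 := (Nat.cast_pos.2 hn).ne'
      rw [(hiter n w).2.1]
      field_simp
    · simp only [Fin.reduceFinMk, map_smul, smul_eq_mul, coord_self]
      rw [if_neg (by decide), mul_zero]
      have := hinv2.mul_const (e.coord 2 w / 2)
      rw [zero_mul] at this
      refine this.congr fun n => ?_
      rw [(hiter n w).2.2, mul_inv]
      field_simp
  set φ₀ := b.coord 2 (e 0) with hφ₀
  have hne : φ₀ ≠ 0 := left_ne_zero_of_mul (hpos _ hu1).ne'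
  have h00 : (φ₀ • e.coord 0) (u 0) = 1 := by
    have := hu 0
    rw [coord_two_eq_sum (e := e), h1, h2, mul_zero, mul_zero, add_zero, add_zero] at this
    exact this
  have h10 : (φ₀ • e.coord 1) (u 0) = 0 := by rw [LinearMap.smul_apply, h1, smul_zero]
  have h20 : (φ₀ • e.coord 2) (u 0) = 0 := by rw [LinearMap.smul_apply, h2, smul_zero]
  have hinj : ∀ v, (φ₀ • e.coord 0) v = 0 → (φ₀ • e.coord 1) v = 0 → (φ₀ • e.coord 2) v = 0 →
      v = 0 := by
    intro v g0 g1 g2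
    refine e.ext_elem fun i => ?_
    rw [map_zero, Finsupp.zero_apply]
    fin_cases i
    · exact (smul_eq_zero.1 g0).resolve_left hne
    · exact (smul_eq_zero.1 g1).resolve_left hne
    · exact (smul_eq_zero.1 g2).resolve_left hne
  obtain ⟨K, hK⟩ := exists_conic_subset hC hu0 h00 h10 h20 hinj hpos (by
    intro n v hv
    obtain ⟨w, hw, g0, g1, g2⟩ := horbit n v hv
    refine ⟨w, hw, ?_⟩
    simp only [LinearMap.smul_apply, smul_eq_mul, g0, g1, g2]
    exact ⟨by ring, by ring, trivial⟩)
  refine peakVolume_lt_top_of_conic hC hu hu1 hu2 hu0 h00 h10 h20 hinj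
    (A := b.coord 2 (e 1) / φ₀) (B := b.coord 2 (e 2) / φ₀) (fun v => ?_) hpos hK
  rw [coord_two_eq_sum (e := e)]
  simp only [LinearMap.smul_apply, smul_eq_mul, ← hφ₀]
  field_simp

end Volume

end

section

/-! ### Automorphisms in normal form -/

variable {b e : Module.Basis (Fin 3) ℝ (Fin 3 → ℝ)} {Ω : Set Plane} {γ : SL(3, ℝ)}

/-- A conjugate of `M` acts by `M` in the coordinates of a suitable basis. -/
theorem ConjTo.exists_basis {M : Matrix (Fin 3) (Fin 3) ℝ} (h : ConjTo γ M) :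
    ∃ e : Module.Basis (Fin 3) ℝ (Fin 3 → ℝ), ∀ v i,
      e.coord i (γ.1.mulVec v) = ∑ j, M i j * e.coord j v := by
  obtain ⟨g, hg⟩ := h
  have h1 : (g : Matrix (Fin 3) (Fin 3) ℝ) *
      ((g⁻¹ : GL (Fin 3) ℝ) : Matrix (Fin 3) (Fin 3) ℝ) = 1 := by
    rw [← Units.val_mul, mul_inv_cancel, Units.val_one]
  have h2 : ((g⁻¹ : GL (Fin 3) ℝ) : Matrix (Fin 3) (Fin 3) ℝ) *
      (g : Matrix (Fin 3) (Fin 3) ℝ) = 1 := by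
    rw [← Units.val_mul, inv_mul_cancel, Units.val_one]
  let E : (Fin 3 → ℝ) ≃ₗ[ℝ] (Fin 3 → ℝ) := LinearEquiv.ofLinearMap
    ((g⁻¹ : GL (Fin 3) ℝ) : Matrix (Fin 3) (Fin 3) ℝ).mulVecLin
    (g : Matrix (Fin 3) (Fin 3) ℝ).mulVecLin
    (by rw [← Matrix.mulVecLin_mul, h2, Matrix.mulVecLin_one])
    (by rw [← Matrix.mulVecLin_mul, h1, Matrix.mulVecLin_one])
  refine ⟨Module.Basis.ofEquivFun E, fun v i => ?_⟩
  have hE : E (γ.1.mulVec v) = M.mulVec (E v) := by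
    change ((g⁻¹ : GL (Fin 3) ℝ) : Matrix (Fin 3) (Fin 3) ℝ).mulVec (γ.1.mulVec v) =
      M.mulVec (((g⁻¹ : GL (Fin 3) ℝ) : Matrix (Fin 3) (Fin 3) ℝ).mulVec v)
    rw [hg, Matrix.mulVec_mulVec, Matrix.mulVec_mulVec, ← Matrix.mul_assoc, ← Matrix.mul_assoc,
      h2, Matrix.one_mul]
  exact congrFun hE i

theorem exists_mulVec_eq_smul {v : Fin 3 → ℝ} (hv : v ≠ 0)
    (h : γ • Projectivization.mk ℝ v hv = Projectivization.mk ℝ v hv) :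
    ∃ a : ℝ, γ.1.mulVec v = a • v := by
  rw [Projectivization.smul_mk, Projectivization.mk_eq_mk_iff'] at h
  obtain ⟨a, ha⟩ := h
  exact ⟨a, ha.symm⟩

theorem mulVec_inv_mulVec (γ : SL(3, ℝ)) (v : Fin 3 → ℝ) :
    γ.1.mulVec ((γ⁻¹).1.mulVec v) = v := by
  rw [Matrix.mulVec_mulVec, ← Matrix.SpecialLinearGroup.coe_mul, mul_inv_cancel,
    Matrix.SpecialLinearGroup.coe_one, Matrix.one_mulVec]

section Types

variable {u : Module.Basis (Fin 3) ℝ (Fin 3 → ℝ)} {C : Set (Fin 3 → ℝ)}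

theorem peakVolume_lt_top_of_isParabolic (hC : IsProperCone b C)
    (hu : ∀ i, b.coord 2 (u i) = 1) (hu1 : u 1 ∈ C) (hu2 : u 2 ∈ C) (hu0 : u 0 ∈ closure C)
    (hNC : ∀ v ∈ C, γ.1.mulVec (γ.1.mulVec v) ∈ C)
    (hNC' : ∀ v ∈ C, (γ⁻¹).1.mulVec ((γ⁻¹).1.mulVec v) ∈ C) {a : ℝ}
    (ha : γ.1.mulVec (u 0) = a • u 0) (h : IsParabolic γ) : peakVolume b u C < ⊤ := by
  obtain ⟨e, he⟩ := ConjTo.exists_basis h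
  have h0 : ∀ v, e.coord 0 (γ.1.mulVec v) = e.coord 0 v + e.coord 1 v := fun v => by
    rw [he, Fin.sum_univ_three]; simp
  have h1 : ∀ v, e.coord 1 (γ.1.mulVec v) = e.coord 1 v + e.coord 2 v := fun v => by
    rw [he, Fin.sum_univ_three]; simp
  have h2 : ∀ v, e.coord 2 (γ.1.mulVec v) = e.coord 2 v := fun v => by
    rw [he, Fin.sum_univ_three]; simp
  have h2' : ∀ v, e.coord 2 ((γ⁻¹).1.mulVec v) = e.coord 2 v := fun v => by
    rw [← h2, mulVec_inv_mulVec]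
  have h1' : ∀ v, e.coord 1 ((γ⁻¹).1.mulVec v) = e.coord 1 v - e.coord 2 v := fun v => by
    have := h1 ((γ⁻¹).1.mulVec v)
    rw [mulVec_inv_mulVec, h2'] at this
    linarith
  have h0' : ∀ v, e.coord 0 ((γ⁻¹).1.mulVec v) = e.coord 0 v - e.coord 1 v + e.coord 2 v :=
    fun v => by
    have := h0 ((γ⁻¹).1.mulVec v)
    rw [mulVec_inv_mulVec, h1'] at this
    linarith
  have f1 := h1 (u 0)
  have f2 := h2 (u 0)
  have f0 := h0 (u 0)
  rw [ha, map_smul, smul_eq_mul] at f0 f1 f2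
  have g2 : e.coord 2 (u 0) = 0 := by
    by_contra hne
    have ha1 : a = 1 := mul_right_cancel₀ hne (f2.trans (one_mul _).symm)
    rw [ha1] at f1
    exact hne (by linarith)
  have g1 : e.coord 1 (u 0) = 0 := by
    rw [g2, add_zero] at f1
    by_contra hne
    have ha1 : a = 1 := mul_right_cancel₀ hne (f1.trans (one_mul _).symm)
    rw [ha1] at f0
    exact hne (by linarith)
  exact peakVolume_lt_top_of_parabolic hC hu hu1 hu2 hu0
    (N := fun v => γ.1.mulVec (γ.1.mulVec v))
    (N' := fun v => (γ⁻¹).1.mulVec ((γ⁻¹).1.mulVec v))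
    (fun v => by rw [h0, h0, h1]; ring) (fun v => by rw [h1, h1, h2]; ring)
    (fun v => by rw [h2, h2]) hNC
    (fun v => by rw [h0', h0', h1', h2']; ring) (fun v => by rw [h1', h1', h2']; ring)
    (fun v => by rw [h2', h2']) hNC' g1 g2

theorem peakVolume_eq_top_of_isQuasiHyperbolic (hC : IsProperCone b C)
    (hu : ∀ i, b.coord 2 (u i) = 1) (hu1 : u 1 ∈ C) (hu2 : u 2 ∈ C) (hu0 : u 0 ∈ closure C)
    (hNC : ∀ v ∈ C, γ.1.mulVec (γ.1.mulVec v) ∈ C)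
    (hNC' : ∀ v ∈ C, (γ⁻¹).1.mulVec ((γ⁻¹).1.mulVec v) ∈ C) {a : ℝ}
    (ha : γ.1.mulVec (u 0) = a • u 0) (h : IsQuasiHyperbolic γ) : peakVolume b u C = ⊤ := by
  obtain ⟨α, β, hα, hβ, hαβ, hα1, -, hconj⟩ := h
  obtain ⟨e, he⟩ := ConjTo.exists_basis hconj
  have hne : α ≠ β := by
    rintro rfl
    refine hα1 ((pow_eq_one_iff_of_nonneg hα.le three_ne_zero).1 ?_)
    rw [← hαβ]; ring
  have h0 : ∀ v, e.coord 0 (γ.1.mulVec v) = α * e.coord 0 v + e.coord 1 v := fun v => by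
    rw [he, Fin.sum_univ_three]; simp
  have h1 : ∀ v, e.coord 1 (γ.1.mulVec v) = α * e.coord 1 v := fun v => by
    rw [he, Fin.sum_univ_three]; simp
  have h2 : ∀ v, e.coord 2 (γ.1.mulVec v) = β * e.coord 2 v := fun v => by
    rw [he, Fin.sum_univ_three]; simp
  have h2' : ∀ v, e.coord 2 ((γ⁻¹).1.mulVec v) = β⁻¹ * e.coord 2 v := fun v => by
    have := h2 ((γ⁻¹).1.mulVec v)
    rw [mulVec_inv_mulVec] at this
    rw [this, inv_mul_cancel_left₀ hβ.ne']
  have h1' : ∀ v, e.coord 1 ((γ⁻¹).1.mulVec v) = α⁻¹ * e.coord 1 v := fun v => by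
    have := h1 ((γ⁻¹).1.mulVec v)
    rw [mulVec_inv_mulVec] at this
    rw [this, inv_mul_cancel_left₀ hα.ne']
  have h0' : ∀ v, e.coord 0 ((γ⁻¹).1.mulVec v) =
      α⁻¹ * e.coord 0 v - α⁻¹ * α⁻¹ * e.coord 1 v := fun v => by
    have := h0 ((γ⁻¹).1.mulVec v)
    rw [mulVec_inv_mulVec, h1'] at this
    rw [this]
    field_simp
    ring
  have f0 := h0 (u 0)
  have f1 := h1 (u 0)
  have f2 := h2 (u 0)
  rw [ha, map_smul, smul_eq_mul] at f0 f1 f2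
  have g1 : e.coord 1 (u 0) = 0 := by
    by_contra hne
    have ha1 : a = α := mul_right_cancel₀ hne f1
    rw [ha1] at f0
    exact hne (by linarith)
  have g02 : e.coord 0 (u 0) = 0 ∨ e.coord 2 (u 0) = 0 := by
    by_contra! hcon
    rw [g1, add_zero] at f0
    exact hne ((mul_right_cancel₀ hcon.1 f0).symm.trans (mul_right_cancel₀ hcon.2 f2))
  have hJ : IsJordanMap e (fun v => γ.1.mulVec (γ.1.mulVec v)) (α ^ 2) (2 * α) (β ^ 2) :=
    ⟨fun v => by rw [h0, h0, h1]; ring, fun v => by rw [h1, h1]; ring,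
      fun v => by rw [h2, h2]; ring⟩
  have hJ' : IsJordanMap e (fun v => (γ⁻¹).1.mulVec ((γ⁻¹).1.mulVec v)) (α⁻¹ ^ 2)
      (-(2 * α⁻¹ ^ 3)) (β⁻¹ ^ 2) :=
    ⟨fun v => by rw [h0', h0', h1']; ring, fun v => by rw [h1', h1']; ring,
      fun v => by rw [h2', h2']; ring⟩
  have hαi := inv_pos.2 hα
  have hβi := inv_pos.2 hβ
  rcases hne.lt_or_gt with hlt | hlt
  · have hlti : β⁻¹ < α⁻¹ := inv_strictAnti₀ hα hlt
    exact peakVolume_eq_top_of_isJordanMap hC hu hu1 hu2 hu0 hJ' hNC' hJ hNC (by positivity)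
      (by gcongr) (by positivity) (by gcongr) (neg_ne_zero.2 (by positivity)) g1 g02
  · have hlti : α⁻¹ < β⁻¹ := inv_strictAnti₀ hβ hlt
    exact peakVolume_eq_top_of_isJordanMap hC hu hu1 hu2 hu0 hJ hNC hJ' hNC' (by positivity)
      (by gcongr) (by positivity) (by gcongr) (by positivity) g1 g02

/-- Coordinates adapted to a hyperbolic automorphism; the functionals dual to the extreme
eigenvalues have constant sign on a stable cone. -/
theorem exists_basis_of_diagonal (hC : IsProperCone b C)
    (hNC : ∀ v ∈ C, γ.1.mulVec (γ.1.mulVec v) ∈ C)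
    (hNC' : ∀ v ∈ C, (γ⁻¹).1.mulVec ((γ⁻¹).1.mulVec v) ∈ C) {lp l0 lm : ℝ} (h0p : l0 < lp)
    (hm0 : lm < l0) (hm : 0 < lm) (hconj : ConjTo γ !![lp, 0, 0; 0, l0, 0; 0, 0, lm]) :
    ∃ e : Module.Basis (Fin 3) ℝ (Fin 3 → ℝ),
      (∀ v i, e.coord i (γ.1.mulVec v) = ![lp, l0, lm] i * e.coord i v) ∧
      (∀ v ∈ C, 0 < b.coord 2 (e 0) * e.coord 0 v) ∧
      (∀ v ∈ C, 0 < b.coord 2 (e 2) * e.coord 2 v) := by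
  obtain ⟨e, he⟩ := ConjTo.exists_basis hconj
  have h : ∀ v i, e.coord i (γ.1.mulVec v) = ![lp, l0, lm] i * e.coord i v := by
    intro v i
    rw [he, Fin.sum_univ_three]
    fin_cases i <;> simp
  have hd : ∀ i, 0 < ![lp, l0, lm] i := by
    intro i
    fin_cases i
    · exact (hm.trans hm0).trans h0p
    · exact hm.trans hm0
    · exact hm
  have h' : ∀ v i, e.coord i ((γ⁻¹).1.mulVec v) = (![lp, l0, lm] i)⁻¹ * e.coord i v := by
    intro v i
    have := h ((γ⁻¹).1.mulVec v) i
    rw [mulVec_inv_mulVec] at this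
    rw [this, inv_mul_cancel_left₀ (hd i).ne']
  have hmax : ∀ i, i ≠ 0 → ![lp, l0, lm] i < ![lp, l0, lm] 0 := by
    intro i hi
    fin_cases i
    · exact absurd rfl hi
    · exact h0p
    · exact hm0.trans h0p
  have hmin : ∀ i, i ≠ 2 → ![lp, l0, lm] 2 < ![lp, l0, lm] i := by
    intro i hi
    fin_cases i
    · exact hm0.trans h0p
    · exact hm0
    · exact absurd rfl hi
  refine ⟨e, h, ?_, ?_⟩
  · refine pos_of_dominating hC (N := fun v => γ.1.mulVec (γ.1.mulVec v))
      (d := fun i => ![lp, l0, lm] i ^ 2) (fun i => pow_pos (hd i) 2) hNC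
      (fun v i => by rw [h, h]; ring) fun j hj => ?_
    exact pow_lt_pow_left₀ (hmax j hj) (hd j).le two_ne_zero
  · refine pos_of_dominating hC (N := fun v => (γ⁻¹).1.mulVec ((γ⁻¹).1.mulVec v))
      (d := fun i => (![lp, l0, lm] i)⁻¹ ^ 2) (fun i => pow_pos (inv_pos.2 (hd i)) 2) hNC'
      (fun v i => by rw [h', h']; ring) fun j hj => ?_
    exact pow_lt_pow_left₀ (inv_strictAnti₀ (hd 2) (hmin j hj)) (inv_pos.2 (hd j)).le two_ne_zero

theorem coord_eq_zero_of_eigenvector {d : Fin 3 → ℝ}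
    (h : ∀ v i, e.coord i (γ.1.mulVec v) = d i * e.coord i v) {v : Fin 3 → ℝ} {a : ℝ}
    (hv : γ.1.mulVec v = a • v) {i : Fin 3} (hi : d i ≠ a) : e.coord i v = 0 := by
  have h1 := h v i
  rw [hv, map_smul, smul_eq_mul] at h1
  by_contra hne
  exact hi (mul_right_cancel₀ hne h1).symm

end Types

/-- If the axis of a hyperbolic automorphism lies in the boundary, the line carrying it misses
`Ω`. Positivity of the product of the two extreme eigencoordinates tells which of the two segments
between the fixed points is the axis. -/
theorem coord_one_ne_zero_of_axis_subset_frontier (hΩ : IsOpen Ω)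
    (hb : closure Ω ⊆ Set.range (affineChart b))
    (hpos0 : ∀ v ∈ coneOver b Ω, 0 < b.coord 2 (e 0) * e.coord 0 v)
    (hpos2 : ∀ v ∈ coneOver b Ω, 0 < b.coord 2 (e 2) * e.coord 2 v) {pp pm : Plane}
    (hpp : ∀ v h, pp = Projectivization.mk ℝ v h → e.coord 1 v = 0 ∧ e.coord 2 v = 0)
    (hpm : ∀ v h, pm = Projectivization.mk ℝ v h → e.coord 0 v = 0 ∧ e.coord 1 v = 0)
    {S : Set Plane} (hS : IsAxis Ω pp pm S) (hSf : S ⊆ frontier Ω) :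
    ∀ v ∈ coneOver b Ω, e.coord 1 v ≠ 0 := by
  obtain ⟨⟨-, x, y, hx, hy, hmx, hmy, rfl⟩, hScl⟩ := hS
  obtain ⟨hx0, hx1⟩ := hpm x hx hmx
  obtain ⟨hy1, hy2⟩ := hpp y hy hmy
  have hxe : x = e.coord 2 x • e 2 := eq_smul_of_coord 2 fun j hj => by
    fin_cases j
    · exact hx0
    · exact hx1
    · exact absurd rfl hj
  have hye : y = e.coord 0 y • e 0 := eq_smul_of_coord 0 fun j hj => by
    fin_cases j
    · exact absurd rfl hj
    · exact hy1
    · exact hy2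
  have hx2 : e.coord 2 x ≠ 0 := fun h => hx (by rw [hxe, h, zero_smul])
  have hy0 : e.coord 0 y ≠ 0 := fun h => hy (by rw [hye, h, zero_smul])
  set φ₀ := b.coord 2 (e 0)
  set φ₂ := b.coord 2 (e 2)
  let q : (Fin 3 → ℝ) → ℝ := fun z => φ₀ * e.coord 0 z * (φ₂ * e.coord 2 z)
  have hqc : Continuous q := by
    have h0 := (e.coord 0).continuous_of_finiteDimensional
    have h2 := (e.coord 2).continuous_of_finiteDimensional
    fun_prop
  have hqs : ∀ (a : ℝ) z, q (a • z) = a ^ 2 * q z := by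
    intro a z
    simp only [q, map_smul, smul_eq_mul]
    ring
  have hqneg : IsOpen {z : Plane | z.rep ∈ {z | q z < 0}} :=
    isOpen_of_isOpen_rep (isOpen_lt hqc continuous_const) fun a z ha hz => by
      change q _ < 0
      rw [hqs]
      exact mul_neg_of_pos_of_neg (by positivity) hz
  have hq : 0 ≤ q (x + y) := by
    by_contra! hneg
    have hne : (1 : ℝ) • x + (1 : ℝ) • y ≠ 0 := by
      rw [one_smul, one_smul]
      intro h0
      rw [h0] at hneg
      simp [q] at hneg
    have hmem : Projectivization.mk ℝ _ hne ∈ closure Ω :=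
      hScl ⟨1, 1, one_pos, one_pos, hne, rfl⟩
    obtain ⟨a, ha⟩ := Projectivization.exists_smul_eq_mk_rep ℝ _ hne
    obtain ⟨z, hz, hzΩ⟩ := mem_closure_iff.1 hmem _ hqneg (by
      change q _ < 0
      rw [← ha, Units.smul_def, hqs, one_smul, one_smul]
      exact mul_neg_of_pos_of_neg (by have := a.ne_zero; positivity) hneg)
    have hz' : q z.rep < 0 := hz
    rw [← z.mk_rep] at hzΩ
    rcases mem_coneOver_or_neg_mem hb z.rep_nonzero hzΩ with h | h
    · exact lt_asymm hz' (mul_pos (hpos0 _ h) (hpos2 _ h))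
    · have h1 : 0 < q (-z.rep) := mul_pos (hpos0 _ h) (hpos2 _ h)
      rw [← neg_one_smul ℝ, hqs] at h1
      linarith
  have hqxy : q (x + y) = φ₀ * e.coord 0 y * (φ₂ * e.coord 2 x) := by
    simp only [q, map_add, hx0, hy2, zero_add, add_zero]
  intro z hz hz1
  have p0 := hpos0 z hz
  have p2 := hpos2 z hz
  have hφ₀ : φ₀ ≠ 0 := left_ne_zero_of_mul p0.ne'
  have hφ₂ : φ₂ ≠ 0 := left_ne_zero_of_mul p2.ne'
  have hqpos : 0 < φ₀ * e.coord 0 y * (φ₂ * e.coord 2 x) :=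
    (hqxy ▸ hq).lt_of_ne (mul_ne_zero (mul_ne_zero hφ₀ hy0) (mul_ne_zero hφ₂ hx2)).symm
  set s := e.coord 2 z / e.coord 2 x with hs
  set t := e.coord 0 z / e.coord 0 y with ht
  have hst : 0 < s * t := by
    have h1 : s * t = φ₀ * e.coord 0 z * (φ₂ * e.coord 2 z) /
        (φ₀ * e.coord 0 y * (φ₂ * e.coord 2 x)) := by
      rw [hs, ht]; field_simp
    rw [h1]
    positivity
  have hzst : z = s • x + t • y := by
    refine e.ext_elem fun i => ?_
    change e.coord i z = e.coord i _
    rw [map_add, map_smul, map_smul, smul_eq_mul, smul_eq_mul]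
    fin_cases i
    · change e.coord 0 z = s * e.coord 0 x + t * e.coord 0 y
      rw [hx0, ht, div_mul_cancel₀ _ hy0]; ring
    · change e.coord 1 z = s * e.coord 1 x + t * e.coord 1 y
      rw [hx1, hy1, hz1]; ring
    · change e.coord 2 z = s * e.coord 2 x + t * e.coord 2 y
      rw [hy2, hs, div_mul_cancel₀ _ hx2]; ring
  have hzS : Projectivization.mk ℝ z hz.2.1 ∈ frontier Ω := by
    refine hSf ?_
    rcases pos_and_pos_or_neg_and_neg_of_mul_pos hst with ⟨h1, h2⟩ | ⟨h1, h2⟩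
    · refine ⟨s, t, h1, h2, by rw [← hzst]; exact hz.2.1, ?_⟩
      congr 1
    · have hneg : (-s) • x + (-t) • y = (-1 : ℝ) • z := by
        rw [hzst]; module
      have hne : (-1 : ℝ) • z ≠ 0 := smul_ne_zero (by norm_num) hz.2.1
      refine ⟨-s, -t, neg_pos.2 h1, neg_pos.2 h2, by rw [hneg]; exact hne, ?_⟩
      rw [← mk_smul_eq hz.2.1 hne]
      congr 1
      exact hneg.symm
  rw [hΩ.frontier_eq] at hzS
  exact hzS.2 hz.2.2

end

end Hilbert

end

theorem mainTheorem10 (Ω : Set Hilbert.Plane) (hopen : IsOpen Ω)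
    (hconv : Hilbert.IsProperlyConvex Ω)
    (P : Set Hilbert.Plane) (p : Hilbert.Plane) (hP : Hilbert.IsPeak Ω p P)
    (γ : SL(3, ℝ)) (hγ : γ ∈ Hilbert.Aut Ω) (hγ1 : γ ≠ 1) (hfix : γ • p = p)
    (b : Module.Basis (Fin 3) ℝ (Fin 3 → ℝ))
    (hb : closure Ω ⊆ Set.range (Hilbert.affineChart b)) :
    (Hilbert.IsParabolic γ → Hilbert.busemannVolume b Ω P < ⊤) ∧
    (Hilbert.IsQuasiHyperbolic γ → Hilbert.busemannVolume b Ω P = ⊤) ∧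
    (∀ pp p0 pm : Hilbert.Plane, Hilbert.IsHyperbolicWith γ pp p0 pm →
      (∀ S : Set Hilbert.Plane, Hilbert.IsAxis Ω pp pm S → S ⊆ frontier Ω →
        Hilbert.busemannVolume b Ω P = ⊤) ∧
      (p = p0 → Hilbert.busemannVolume b Ω P = ⊤)) := by
  open Hilbert in
  have hC := isProperCone_coneOver hopen hconv.1 hb
  obtain ⟨u, hu, hu0, hu1, hu2, hp, hvol⟩ := hP.exists_basis hopen hb
  have hNC : ∀ v ∈ coneOver b Ω, γ.1.mulVec (γ.1.mulVec v) ∈ coneOver b Ω :=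
    fun v hv => mulVec_mulVec_mem_coneOver hC hb hγ hv
  have hNC' : ∀ v ∈ coneOver b Ω, (γ⁻¹).1.mulVec ((γ⁻¹).1.mulVec v) ∈ coneOver b Ω :=
    fun v hv => mulVec_mulVec_mem_coneOver hC hb (inv_mem hγ) hv
  rw [hp] at hfix
  obtain ⟨a, ha⟩ := exists_mulVec_eq_smul (u.ne_zero 0) hfix
  rw [hvol]
  refine ⟨peakVolume_lt_top_of_isParabolic hC hu hu1 hu2 hu0 hNC hNC' ha,
    peakVolume_eq_top_of_isQuasiHyperbolic hC hu hu1 hu2 hu0 hNC hNC' ha, ?_⟩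
  rintro pp p0 pm ⟨lp, l0, lm, h0p, hm0, hm, -, hconj, ⟨x, hx, hxe, rfl⟩, ⟨y, hy, hye, rfl⟩,
    ⟨z, hz, hze, rfl⟩⟩
  obtain ⟨e, he, hpos0, hpos2⟩ := exists_basis_of_diagonal hC hNC hNC' h0p hm0 hm hconj
  -- representatives of an eigenpoint are eigenvectors
  have heig : ∀ {w : Fin 3 → ℝ} {c : ℝ} (hw : w ≠ 0), γ.1.mulVec w = c • w → ∀ v h,
      Projectivization.mk ℝ w hw = Projectivization.mk ℝ v h → γ.1.mulVec v = c • v := by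
    intro w c hw hwe v h hwv
    obtain ⟨r, hr⟩ := (Projectivization.mk_eq_mk_iff' ℝ v w h hw).1 hwv.symm
    rw [← hr, Matrix.mulVec_smul, hwe, smul_comm]
  constructor
  · intro S hS hSf
    have hne := coord_one_ne_zero_of_axis_subset_frontier hopen hb hpos0 hpos2
      (fun v h hv => ⟨coord_eq_zero_of_eigenvector he (heig hx hxe v h hv) (i := 1) h0p.ne,
        coord_eq_zero_of_eigenvector he (heig hx hxe v h hv) (i := 2) (hm0.trans h0p).ne⟩)
      (fun v h hv => ⟨coord_eq_zero_of_eigenvector he (heig hz hze v h hv) (i := 0)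
          (hm0.trans h0p).ne',
        coord_eq_zero_of_eigenvector he (heig hz hze v h hv) (i := 1) hm0.ne'⟩) hS hSf
    obtain ⟨s, -, hpos1⟩ := hC.exists_sign hne
    -- the vertex is one of the eigenpoints, hence a corner of a triangle containing `Ω`
    by_cases ha0 : lp = a
    · exact peakVolume_eq_top_of_signs hC hu hu1 hu2 hu0 (i := 1) (j := 2) (k := 0) (by decide)
        hpos1 hpos2
        (coord_eq_zero_of_eigenvector he ha (ha0 ▸ h0p.ne : l0 ≠ a))
        (coord_eq_zero_of_eigenvector he ha (ha0 ▸ (hm0.trans h0p).ne : lm ≠ a))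
    have g0 := coord_eq_zero_of_eigenvector he ha (i := 0) ha0
    by_cases ha1 : l0 = a
    · exact peakVolume_eq_top_of_signs hC hu hu1 hu2 hu0 (i := 0) (j := 2) (k := 1) (by decide)
        hpos0 hpos2 g0 (coord_eq_zero_of_eigenvector he ha (ha1 ▸ hm0.ne : lm ≠ a))
    · exact peakVolume_eq_top_of_signs hC hu hu1 hu2 hu0 (i := 0) (j := 1) (k := 2) (by decide)
        hpos0 hpos1 g0 (coord_eq_zero_of_eigenvector he ha (i := 1) ha1)
  · intro hp0
    have hu0e := heig hy hye (u 0) (u.ne_zero 0) (hp0.symm.trans hp)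
    exact peakVolume_eq_top_of_signs hC hu hu1 hu2 hu0 (i := 0) (j := 2) (k := 1) (by decide)
      hpos0 hpos2 (coord_eq_zero_of_eigenvector he hu0e (i := 0) h0p.ne')
      (coord_eq_zero_of_eigenvector he hu0e (i := 2) hm0.ne)
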